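/- A \emph{connected dominating set} (CDS) of a finite simple graph $H$ is a set $\tau$ of vertices such that every vertex outside $\tau$ has a neighbor in $\tau$ and the induced subgraph $H[\tau]$ is connected (in particular non-empty). A \emph{CDS packing} of $H$ assigns a weight $x_\tau\ge 0$ to every CDS $\tau$ of $H$ such that $\sum_{\tau\ni v}x_\tau\le 1$ for every vertex $v$; its \emph{size} is $\sum_\tau x_\tau$. A graph is $k$-vertex-connected if it has more than $k$ vertices and stays connected after the removal of any fewer than $k$ vertices; its vertex connectivity is the largest such $k$ (and $0$ for the graph without vertices). Theorem. For every $a>0$ there are constants $c,C>0$, depending only on $a$, such that the following holds. Let $G=(V,E)$ be a $k$-vertex-connected graph with $n$ vertices, let $p\in[0,1]$ satisfy $kp^2\ge C\log^2 n$, and let $S\subseteq V$ be the random set that contains each vertex $v\in V$ independently with probability $p$. Then, with probability at least $1-n^{-a}$, the induced subgraph $G[S]$ has a CDS packing of size at least $c\,\frac{kp^2}{\log^3 n}$ and also has vertex connectivity at least $c\,\frac{kp^2}{\log^3 n}$. (For $n=1$ the quotient is read as $0$.) -/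

import Mathlib

open scoped ProbabilityTheory unitInterval

namespace SimpleGraph

/-- `D` is a dominating set of `G`: every vertex outside `D` has a neighbour in `D`. -/
def IsDominatingSet {V : Type*} (G : SimpleGraph V) (D : Set V) : Prop :=
  ∀ u, u ∉ D → ∃ v ∈ D, G.Adj u v

/-- `D` is a connected dominating set (CDS) of `G`. In particular `D` is nonempty. -/
def IsCDS {V : Type*} (G : SimpleGraph V) (D : Set V) : Prop :=
  G.IsDominatingSet D ∧ (G.induce D).Connected

/-- A CDS packing of a finite graph: nonnegative weights on the connected dominating sets such that
for every vertex the weights of the sets containing it sum to at most one. -/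
structure CDSPacking {V : Type*} [Finite V] (G : SimpleGraph V) where
  /-- the weight of each connected dominating set -/
  weight : {τ : Set V // G.IsCDS τ} → ℝ
  weight_nonneg : ∀ τ, 0 ≤ weight τ
  sum_le_one : ∀ v : V, ∑ᶠ (τ : {τ : Set V // G.IsCDS τ}) (_ : v ∈ τ.1), weight τ ≤ 1

/-- The size of a CDS packing is its total weight. -/
noncomputable def CDSPacking.size {V : Type*} [Finite V] {G : SimpleGraph V}
    (P : G.CDSPacking) : ℝ :=
  ∑ᶠ τ, P.weight τ

/-- `G` is `k`-vertex-connected: it has more than `k` vertices, and deleting fewer than `k` vertices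
always leaves a connected graph. -/
def IsVertexConnected {V : Type*} [Finite V] (G : SimpleGraph V) (k : ℕ) : Prop :=
  k < Nat.card V ∧ ∀ T : Set V, T.ncard < k → (G.induce Tᶜ).Connected

/-- The vertex connectivity of a finite graph: the largest `k` such that the graph is
`k`-vertex-connected (and `0` for the graph without vertices). -/
noncomputable def vertexConnectivity {V : Type*} [Finite V] (G : SimpleGraph V) : ℕ :=
  sSup {k | G.IsVertexConnected k}

end SimpleGraph

/-! With R of order log n, N = 2R + 1 and q = p/N, Bernoulli's inequality shows that a sample of
density p contains the union of N independent samples of density q. Fix t ≈ kp²/(2N²) colours. The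
aim is t connected subsets of S, each totally dominating G, with every vertex in at most N of them.
Weight 1/N on each gives a packing of size t/N. Deleting fewer than t/N vertices misses some member
entirely, which still connects all that remains of S. Both quantities are of order kp²/log³ n.

One sample, coloured uniformly, supplies the initial sets: degrees are at least k, so all colour
classes are totally dominating with high probability. Each of R rounds then spends two samples, a
coloured X and an uncoloured Y, and shrinks the expected total number of excess components by the
factor 31/32. After R rounds Markov's inequality finishes.

A round works because of `exists_connectors`: by Menger-type reasoning, a component C that is not
alone in its set has either k/2 single vertices joining it to the rest of the set, or k/4 disjoint
edges uw with u touching only C and w missing C. Since w has a neighbour in the set by total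
domination, such an edge joins C to another component. A single vertex succeeds if X gives it the
right colour. An edge needs w to get colour i in X and u to lie in Y, which has probability q²/t;
this is where p² comes from. The vertex u takes its colour from its partners in X, and only if
exactly one colour is proposed, so a round puts a vertex into at most two new sets. Conflicts cost
at most half the probability (`pprob_conflict_le`), and a second-order Bonferroni bound gives each
such C a constant chance of merging. -/

section ProductExpectation

/-! ### Independent coordinates: expectations as finite weighted sums. -/

variable {V α β ι : Type*} [Fintype V] [DecidableEq V] [Fintype α] [Fintype β]

/-- A probability weight on a finite type. -/
structure IsProbWeight (w : α → ℝ) : Prop where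
  nonneg : ∀ a, 0 ≤ w a
  sum_eq_one : ∑ a, w a = 1

/-- The expectation of `f` on `V → α` when the coordinates are independent with weight `w`. -/
noncomputable def pexp (w : α → ℝ) (f : (V → α) → ℝ) : ℝ :=
  ∑ X : V → α, (∏ v, w (X v)) * f X

open Classical in
/-- The real number `1` if `P` holds, and `0` otherwise. -/
noncomputable def indicatorProp (P : Prop) : ℝ := if P then 1 else 0

@[simp]
theorem indicatorProp_of_true {P : Prop} (h : P) : indicatorProp P = 1 := if_pos h

@[simp]
theorem indicatorProp_of_not {P : Prop} (h : ¬ P) : indicatorProp P = 0 := if_neg h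

theorem indicatorProp_nonneg (P : Prop) : 0 ≤ indicatorProp P := by
  by_cases h : P <;> simp [h]

theorem indicatorProp_le_one (P : Prop) : indicatorProp P ≤ 1 := by
  by_cases h : P <;> simp [h]

theorem indicatorProp_mono {P Q : Prop} (h : P → Q) : indicatorProp P ≤ indicatorProp Q := by
  by_cases hP : P
  · simp [hP, h hP]
  · simp [hP, indicatorProp_nonneg]

/-- The probability of an event on `V → α` when the coordinates are independent with weight `w`. -/
noncomputable def pprob (w : α → ℝ) (P : (V → α) → Prop) : ℝ :=
  pexp w fun X ↦ indicatorProp (P X)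

theorem pexp_mono {w : α → ℝ} (hw : IsProbWeight w) {f g : (V → α) → ℝ} (h : ∀ X, f X ≤ g X) :
    pexp w f ≤ pexp w g :=
  Finset.sum_le_sum fun X _ ↦
    mul_le_mul_of_nonneg_left (h X) (Finset.prod_nonneg fun _ _ ↦ hw.nonneg _)

theorem pexp_add (w : α → ℝ) (f g : (V → α) → ℝ) :
    pexp w (fun X ↦ f X + g X) = pexp w f + pexp w g := by
  simp [pexp, mul_add, Finset.sum_add_distrib]

theorem pexp_sub (w : α → ℝ) (f g : (V → α) → ℝ) :
    pexp w (fun X ↦ f X - g X) = pexp w f - pexp w g := by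
  simp [pexp, mul_sub, Finset.sum_sub_distrib]

theorem pexp_const_mul (w : α → ℝ) (c : ℝ) (f : (V → α) → ℝ) :
    pexp w (fun X ↦ c * f X) = c * pexp w f := by
  simp only [pexp, Finset.mul_sum]
  exact Finset.sum_congr rfl fun _ _ ↦ by ring

theorem pexp_mul_const (w : α → ℝ) (c : ℝ) (f : (V → α) → ℝ) :
    pexp w (fun X ↦ f X * c) = pexp w f * c := by
  simp only [pexp, Finset.sum_mul]
  exact Finset.sum_congr rfl fun _ _ ↦ by ring

theorem pexp_sum (w : α → ℝ) (s : Finset ι) (f : ι → (V → α) → ℝ) :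
    pexp w (fun X ↦ ∑ i ∈ s, f i X) = ∑ i ∈ s, pexp w (f i) := by
  simp only [pexp, Finset.mul_sum]
  rw [Finset.sum_comm]

theorem pexp_prod (w : α → ℝ) (f : V → α → ℝ) :
    pexp w (fun X ↦ ∏ v, f v (X v)) = ∏ v, ∑ a, w a * f v a := by
  simp only [pexp, ← Finset.prod_mul_distrib]
  rw [Finset.prod_univ_sum, Fintype.piFinset_univ]

theorem pexp_const {w : α → ℝ} (hw : IsProbWeight w) (c : ℝ) :
    pexp w (fun _ : V → α ↦ c) = c := by
  have h := pexp_prod (V := V) w fun _ _ ↦ 1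
  simp only [Finset.prod_const_one, mul_one, hw.sum_eq_one] at h
  have := pexp_const_mul (V := V) w c fun _ ↦ 1
  simpa [h] using this

theorem pexp_nonneg {w : α → ℝ} (hw : IsProbWeight w) {f : (V → α) → ℝ} (h : ∀ X, 0 ≤ f X) :
    0 ≤ pexp w f :=
  Finset.sum_nonneg fun X _ ↦ mul_nonneg (Finset.prod_nonneg fun _ _ ↦ hw.nonneg _) (h X)

open Classical in
/-- Expectations are transported along coordinatewise maps. -/
theorem pexp_comp (w : α → ℝ) (w' : β → ℝ) (π : α → β)
    (hπ : ∀ b, w' b = ∑ a, if π a = b then w a else 0) (f : (V → β) → ℝ) :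
    pexp w (fun X ↦ f fun v ↦ π (X v)) = pexp w' f := by
  simp only [pexp, hπ]
  have h : ∀ Y : V → β, (∏ v, ∑ a, if π a = Y v then w a else 0) =
      ∑ X : V → α, if (fun v ↦ π (X v)) = Y then ∏ v, w (X v) else 0 := by
    intro Y
    rw [Finset.prod_univ_sum, Fintype.piFinset_univ]
    refine Finset.sum_congr rfl fun X _ ↦ ?_
    by_cases hX : (fun v ↦ π (X v)) = Y
    · rw [if_pos hX]
      exact Finset.prod_congr rfl fun v _ ↦ if_pos (congrFun hX v)
    · rw [if_neg hX]
      obtain ⟨v, hv⟩ := Function.ne_iff.1 hX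
      exact Finset.prod_eq_zero (Finset.mem_univ v) (if_neg hv)
  simp only [h, Finset.sum_mul]
  rw [Finset.sum_comm]
  refine Finset.sum_congr rfl fun X _ ↦ ?_
  simp [ite_mul]

/-- Fubini for independent pairs of coordinates. -/
theorem pexp_mul_weight (w : α → ℝ) (w' : β → ℝ) (f : (V → α × β) → ℝ) :
    pexp (fun x : α × β ↦ w x.1 * w' x.2) f =
      pexp w fun X ↦ pexp w' fun Y ↦ f fun v ↦ (X v, Y v) := by
  simp only [pexp, Finset.mul_sum]
  rw [← Fintype.sum_prod_type']
  refine Fintype.sum_equiv (Equiv.arrowProdEquivProdArrow V (fun _ ↦ α) (fun _ ↦ β)) _ _ fun X ↦ ?_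
  simp [Equiv.arrowProdEquivProdArrow, Finset.prod_mul_distrib, mul_assoc]

theorem pprob_mono {w : α → ℝ} (hw : IsProbWeight w) {P Q : (V → α) → Prop}
    (h : ∀ X, P X → Q X) : pprob w P ≤ pprob w Q :=
  pexp_mono hw fun X ↦ indicatorProp_mono (h X)

theorem pprob_le_one {w : α → ℝ} (hw : IsProbWeight w) (P : (V → α) → Prop) : pprob w P ≤ 1 :=
  (pexp_mono hw fun _ ↦ indicatorProp_le_one _).trans_eq (pexp_const hw 1)

theorem pprob_not {w : α → ℝ} (hw : IsProbWeight w) (P : (V → α) → Prop) :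
    pprob w (fun X ↦ ¬ P X) = 1 - pprob w P := by
  rw [← pexp_const (V := V) hw 1, pprob, pprob, ← pexp_sub]
  congr 1
  ext X
  by_cases h : P X <;> simp [h]

theorem pprob_exists_le {w : α → ℝ} (hw : IsProbWeight w) (s : Finset ι)
    (P : ι → (V → α) → Prop) :
    pprob w (fun X ↦ ∃ i ∈ s, P i X) ≤ ∑ i ∈ s, pprob w (P i) := by
  classical
  simp only [pprob]
  rw [← pexp_sum]
  refine pexp_mono hw fun X ↦ ?_
  by_cases h : ∃ i ∈ s, P i X
  · obtain ⟨i, hi, hP⟩ := h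
    exact (indicatorProp_le_one _).trans ((indicatorProp_of_true hP).ge.trans
      (Finset.single_le_sum (f := fun i ↦ indicatorProp (P i X))
        (fun j _ ↦ indicatorProp_nonneg _) hi))
  · rw [indicatorProp_of_not h]
    exact Finset.sum_nonneg fun j _ ↦ indicatorProp_nonneg _

theorem pprob_and_not (w : α → ℝ) (P Q : (V → α) → Prop) :
    pprob w (fun X ↦ P X ∧ ¬ Q X) = pprob w P - pprob w fun X ↦ P X ∧ Q X := by
  rw [pprob, pprob, pprob, ← pexp_sub]
  congr 1
  ext X
  by_cases h : P X <;> by_cases h' : Q X <;> simp [h, h']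

open Classical in
theorem pprob_forall_mem {w : α → ℝ} (hw : IsProbWeight w) (s : Finset V) (T : V → α → Prop) :
    pprob w (fun X : V → α ↦ ∀ v ∈ s, T v (X v)) =
      ∏ v ∈ s, ∑ a, if T v a then w a else 0 := by
  have h := pexp_prod (V := V) w fun v a ↦ if v ∈ s → T v a then 1 else 0
  rw [pprob]
  calc _ = pexp w fun X ↦ ∏ v, if v ∈ s → T v (X v) then (1 : ℝ) else 0 := by
        congr 1
        ext X
        rw [Finset.prod_ite_zero]
        simp [indicatorProp]
    _ = _ := by
        rw [h, ← Finset.prod_subset (Finset.subset_univ s)]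
        · refine Finset.prod_congr rfl fun v hv ↦ Finset.sum_congr rfl fun a _ ↦ ?_
          simp [hv]
        · intro v _ hv
          simp [hv, hw.sum_eq_one]

open Classical in
theorem pprob_single {w : α → ℝ} (hw : IsProbWeight w) (v : V) (T : α → Prop) :
    pprob w (fun X : V → α ↦ T (X v)) = ∑ a, if T a then w a else 0 := by
  simpa using pprob_forall_mem hw {v} fun _ ↦ T

open Classical in
theorem pprob_pair {w : α → ℝ} (hw : IsProbWeight w) {u v : V} (huv : u ≠ v) (T T' : α → Prop) :
    pprob w (fun X : V → α ↦ T (X u) ∧ T' (X v)) =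
      (∑ a, if T a then w a else 0) * ∑ a, if T' a then w a else 0 := by
  have h := pprob_forall_mem hw {u, v} fun x ↦ if x = u then T else T'
  simpa [Finset.prod_pair huv, huv.symm] using h

end ProductExpectation

/-! ### Coins, random colours, and splitting a sample into independent ones. -/

section Weights

variable {V ι : Type*} [Fintype V] [DecidableEq V] [Fintype ι]

open Classical in
/-- The weight of a coin that shows `True` with probability `q`. -/
noncomputable def coinWeight (q : ℝ) (b : Prop) : ℝ := if b then q else 1 - q

/-- The weight of a random colour, which is present with probability `q` and then uniform. -/
noncomputable def colourWeight (ι : Type*) [Fintype ι] (q : ℝ) : Option ι → ℝ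
  | none => 1 - q
  | some _ => q / Fintype.card ι

theorem sum_prop (f : Prop → ℝ) : ∑ b, f b = f True + f False := by
  rw [Fintype.univ_Prop, Finset.sum_pair (by simp)]

theorem isProbWeight_coinWeight {q : ℝ} (h0 : 0 ≤ q) (h1 : q ≤ 1) :
    IsProbWeight (coinWeight q) where
  nonneg b := by unfold coinWeight; split_ifs <;> linarith
  sum_eq_one := by simp [coinWeight]

theorem isProbWeight_colourWeight [Nonempty ι] {q : ℝ} (h0 : 0 ≤ q) (h1 : q ≤ 1) :
    IsProbWeight (colourWeight ι q) where
  nonneg b := by cases b <;> simp only [colourWeight] <;> [linarith; positivity]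
  sum_eq_one := by
    rw [Fintype.sum_option]
    simp only [colourWeight, Finset.sum_const, Finset.card_univ, nsmul_eq_mul]
    have : (Fintype.card ι : ℝ) ≠ 0 := by simp
    field_simp
    ring

theorem pprob_coin {q : ℝ} (h0 : 0 ≤ q) (h1 : q ≤ 1) (v : V) :
    pprob (coinWeight q) (fun X : V → Prop ↦ X v) = q := by
  have := pprob_single (isProbWeight_coinWeight h0 h1) v fun b ↦ b
  rw [this, sum_prop]
  simp [coinWeight]

theorem pprob_coin_pair {q : ℝ} (h0 : 0 ≤ q) (h1 : q ≤ 1) {u v : V} (huv : u ≠ v) :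
    pprob (coinWeight q) (fun X : V → Prop ↦ X u ∧ X v) = q * q := by
  have := pprob_pair (isProbWeight_coinWeight h0 h1) huv (fun b ↦ b) fun b ↦ b
  rw [this, sum_prop]
  simp [coinWeight]

theorem pprob_colour [Nonempty ι] {q : ℝ} (h0 : 0 ≤ q) (h1 : q ≤ 1) (v : V) (i : ι) :
    pprob (colourWeight ι q) (fun X : V → Option ι ↦ X v = some i) = q / Fintype.card ι := by
  classical
  have := pprob_single (isProbWeight_colourWeight (ι := ι) h0 h1) v fun b ↦ b = some i
  rw [this]
  simp [colourWeight]

theorem pprob_colour_pair [Nonempty ι] {q : ℝ} (h0 : 0 ≤ q) (h1 : q ≤ 1) {u v : V} (huv : u ≠ v)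
    (i j : ι) :
    pprob (colourWeight ι q) (fun X : V → Option ι ↦ X u = some i ∧ X v = some j) =
      (q / Fintype.card ι) * (q / Fintype.card ι) := by
  classical
  have := pprob_pair (isProbWeight_colourWeight (ι := ι) h0 h1) huv (fun b ↦ b = some i)
    fun b ↦ b = some j
  rw [this]
  simp [colourWeight]

theorem pprob_colour_avoid [Nonempty ι] {q : ℝ} (h0 : 0 ≤ q) (h1 : q ≤ 1) (s : Finset V) (i : ι) :
    pprob (colourWeight ι q) (fun X : V → Option ι ↦ ∀ v ∈ s, X v ≠ some i) =
      (1 - q / Fintype.card ι) ^ s.card := by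
  classical
  have hw := isProbWeight_colourWeight (ι := ι) h0 h1
  rw [pprob_forall_mem hw s fun _ b ↦ b ≠ some i, Finset.prod_const]
  congr 1
  rw [← hw.sum_eq_one, eq_sub_iff_add_eq]
  have : q / (Fintype.card ι : ℝ) = ∑ a, if a = some i then colourWeight ι q a else 0 := by
    simp [colourWeight]
  rw [this, ← Finset.sum_add_distrib]
  refine Finset.sum_congr rfl fun a _ ↦ ?_
  by_cases h : a = some i <;> simp [h]

/-- Splitting a sample of density `p` into an independent coloured sample of density `q`, and a
further sample of density `p'`. -/
theorem pexp_coinWeight_split_colour [Nonempty ι] {p q p' : ℝ}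
    (h : 1 - p = (1 - q) * (1 - p')) (f : (V → Prop) → ℝ) :
    pexp (coinWeight p) f = pexp (colourWeight ι q) fun X ↦ pexp (coinWeight p') fun Z ↦
      f fun v ↦ (X v).isSome ∨ Z v := by
  classical
  rw [← pexp_mul_weight (colourWeight ι q) (coinWeight p')
    fun X ↦ f fun v ↦ ((X v).1.isSome ∨ (X v).2 : Prop)]
  have hc : (Fintype.card ι : ℝ) ≠ 0 := by simp
  refine (pexp_comp _ _ (fun x : Option ι × Prop ↦ ((x.1.isSome ∨ x.2 : Prop))) ?_ f).symm
  intro b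
  rw [Fintype.sum_prod_type, Fintype.sum_option]
  simp only [sum_prop]
  by_cases hb : b
  · simp [hb, coinWeight, colourWeight]
    field_simp
    linarith
  · simp [hb, coinWeight, colourWeight]
    linarith

/-- Splitting a sample of density `p` into independent samples of densities `q` and `p'`. -/
theorem pexp_coinWeight_split {p q p' : ℝ}
    (h : 1 - p = (1 - q) * (1 - p')) (f : (V → Prop) → ℝ) :
    pexp (coinWeight p) f = pexp (coinWeight q) fun X ↦ pexp (coinWeight p') fun Z ↦
      f fun v ↦ X v ∨ Z v := by
  classical
  rw [← pexp_mul_weight (coinWeight q) (coinWeight p') fun X ↦ f fun v ↦ ((X v).1 ∨ (X v).2 : Prop)]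
  refine (pexp_comp _ _ (fun x : Prop × Prop ↦ ((x.1 ∨ x.2 : Prop))) ?_ f).symm
  intro b
  rw [Fintype.sum_prod_type]
  simp only [sum_prop]
  by_cases hb : b
  · simp [hb, coinWeight]
    linarith
  · simp [hb, coinWeight]
    linarith

-- The only bridge to measure theory: every probability estimate is made on finite sums.
open ProbabilityTheory MeasureTheory in
theorem setBernoulli_real_eq_pprob (p : I) (E : Set (Set V)) :
    (setBer((Set.univ : Set V), p)).real E =
      pprob (coinWeight p) fun X : V → Prop ↦ {v | X v} ∈ E := by
  classical
  have h1 : (setBer((Set.univ : Set V), p)).real E =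
      ∑ S ∈ (Set.toFinite E).toFinset, (setBer((Set.univ : Set V), p)).real {S} := by
    conv_lhs => rw [← Set.biUnion_of_singleton E]
    rw [show (⋃ x ∈ E, {x}) = ⋃ x ∈ (Set.toFinite E).toFinset, {x} by simp]
    exact measureReal_biUnion_finset (by
      intro x _ y _ hxy
      simpa [Function.onFun] using hxy) (by simp)
  rw [h1]
  simp only [pprob, pexp, indicatorProp, mul_ite, mul_one, mul_zero]
  rw [← Finset.sum_filter]
  refine Finset.sum_bij' (fun S _ ↦ fun v ↦ v ∈ S) (fun X _ ↦ {v | X v}) ?_ ?_ ?_ ?_ ?_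
  · intro S hS
    simpa using hS
  · intro X hX
    simpa using hX
  · intro S hS
    rfl
  · intro X hX
    rfl
  · intro S hS
    rw [setBernoulli_real_singleton p (Set.subset_univ S) Set.finite_univ]
    simp only [coinWeight]
    rw [Finset.prod_ite, Finset.prod_const, Finset.prod_const]
    congr 2
    · rw [← Set.ncard_coe_finset]; simp
    · rw [← Set.ncard_coe_finset]; congr 1; ext; simp

end Weights

/-! ### Components of induced subgraphs and the connectors between them. -/

namespace SimpleGraph

variable {V : Type*} {G : SimpleGraph V}

/-- Every vertex has a neighbour in `A`. -/
def IsTotalDominatingSet (G : SimpleGraph V) (A : Set V) : Prop :=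
  ∀ v, ∃ u ∈ A, G.Adj v u

theorem IsTotalDominatingSet.mono {A B : Set V} (h : G.IsTotalDominatingSet A) (hAB : A ⊆ B) :
    G.IsTotalDominatingSet B := fun v ↦
  let ⟨u, hu, huv⟩ := h v
  ⟨u, hAB hu, huv⟩

theorem Reachable.closed {u v : V} (h : G.Reachable u v) {P : V → Prop}
    (hP : ∀ x y, P x → G.Adj x y → P y) (hu : P u) : P v := by
  rw [reachable_iff_reflTransGen] at h
  induction h with
  | refl => exact hu
  | tail _ hxy ih => exact hP _ _ ih hxy

/-- The number of connected components of the subgraph induced by `A`. -/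
noncomputable def numComponents (G : SimpleGraph V) (A : Set V) : ℕ :=
  Nat.card (G.induce A).ConnectedComponent

/-- The vertices of a component of an induced subgraph, as vertices of the ambient graph. -/
def componentSet {A : Set V} (C : (G.induce A).ConnectedComponent) : Set V :=
  {v | ∃ h : v ∈ A, (G.induce A).connectedComponentMk ⟨v, h⟩ = C}

/-- The map between components given by an inclusion of vertex sets. -/
def componentMap {A B : Set V} (h : A ⊆ B) :
    (G.induce A).ConnectedComponent → (G.induce B).ConnectedComponent :=
  ConnectedComponent.map (G.induceHomOfLE h).toHom

theorem componentSet_nonempty {A : Set V} (C : (G.induce A).ConnectedComponent) :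
    (componentSet C).Nonempty := by
  induction C using ConnectedComponent.ind with
  | _ v => exact ⟨v, v.2, rfl⟩

theorem componentSet_adj {A : Set V} {C : (G.induce A).ConnectedComponent} {x y : V}
    (hx : x ∈ componentSet C) (hy : y ∈ A) (hxy : G.Adj x y) : y ∈ componentSet C := by
  obtain ⟨hxA, rfl⟩ := hx
  refine ⟨hy, ConnectedComponent.connectedComponentMk_eq_of_adj ?_⟩
  exact hxy.symm

theorem eq_of_mem_componentSet {A : Set V} {C C' : (G.induce A).ConnectedComponent} {x : V}
    (h : x ∈ componentSet C) (h' : x ∈ componentSet C') : C = C' := by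
  obtain ⟨_, rfl⟩ := h
  obtain ⟨_, rfl⟩ := h'
  rfl

/-- The components of `A` that are joined to another component in the larger set `B`. -/
def mergedComponents {A B : Set V} (G : SimpleGraph V) (h : A ⊆ B) :
    Set (G.induce A).ConnectedComponent :=
  {C | ∃ C', C' ≠ C ∧ componentMap h C' = componentMap h C}

theorem mem_mergedComponents {A B : Set V} (h : A ⊆ B) {C : (G.induce A).ConnectedComponent}
    {c c' : V} (hc : c ∈ componentSet C) (hc' : c' ∈ A) (hcc' : c' ∉ componentSet C)
    (hr : (G.induce B).Reachable ⟨c', h hc'⟩ ⟨c, h hc.1⟩) : C ∈ mergedComponents G h := by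
  refine ⟨(G.induce A).connectedComponentMk ⟨c', hc'⟩, fun h' ↦ hcc' ⟨hc', h'⟩, ?_⟩
  obtain ⟨hcA, rfl⟩ := hc
  exact ConnectedComponent.sound hr

theorem mem_mergedComponents_of_common_neighbor {A B : Set V} (h : A ⊆ B)
    {C : (G.induce A).ConnectedComponent} {c c' x : V} (hx : x ∈ B) (hc : c ∈ componentSet C)
    (hc' : c' ∈ A) (hcc' : c' ∉ componentSet C) (hxc : G.Adj x c) (hxc' : G.Adj x c') :
    C ∈ mergedComponents G h := by
  refine mem_mergedComponents h hc hc' hcc' ?_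
  have h1 : (G.induce B).Adj ⟨c', h hc'⟩ ⟨x, hx⟩ := hxc'.symm
  have h2 : (G.induce B).Adj ⟨x, hx⟩ ⟨c, h hc.1⟩ := hxc
  exact h1.reachable.trans h2.reachable

theorem mem_mergedComponents_of_adj {A B : Set V} (h : A ⊆ B)
    {C : (G.induce A).ConnectedComponent} {c c' u w : V} (hu : u ∈ B) (hw : w ∈ B)
    (hc : c ∈ componentSet C) (hc' : c' ∈ A) (hcc' : c' ∉ componentSet C)
    (huc : G.Adj u c) (huw : G.Adj u w) (hwc' : G.Adj w c') :
    C ∈ mergedComponents G h := by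
  refine mem_mergedComponents h hc hc' hcc' ?_
  have h1 : (G.induce B).Adj ⟨c', h hc'⟩ ⟨w, hw⟩ := hwc'.symm
  have h2 : (G.induce B).Adj ⟨w, hw⟩ ⟨u, hu⟩ := huw.symm
  have h3 : (G.induce B).Adj ⟨u, hu⟩ ⟨c, h hc.1⟩ := huc
  exact (h1.reachable.trans h2.reachable).trans h3.reachable

/-- Every vertex of `B` has a neighbour in `A`, so enlarging `A` creates no new component. -/
theorem componentMap_surjective {A B : Set V} (hA : G.IsTotalDominatingSet A) (h : A ⊆ B) :
    Function.Surjective (componentMap (G := G) h) := by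
  intro D
  induction D using ConnectedComponent.ind with
  | _ v =>
    obtain ⟨u, hu, huv⟩ := hA v
    refine ⟨(G.induce A).connectedComponentMk ⟨u, hu⟩, ?_⟩
    have hadj : (G.induce B).Adj ⟨u, h hu⟩ v := huv.symm
    exact ConnectedComponent.connectedComponentMk_eq_of_adj hadj

/-- A surjection is at least two to one on the points that share their image with another one. -/
theorem two_mul_card_add_ncard_le {α β : Type*} [Finite α] (f : α → β)
    (hf : Function.Surjective f) :
    2 * Nat.card β + {a | ∃ a', a' ≠ a ∧ f a' = f a}.ncard ≤ 2 * Nat.card α := by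
  classical
  have : Fintype α := Fintype.ofFinite α
  have : Finite β := Finite.of_surjective f hf
  have : Fintype β := Fintype.ofFinite β
  set M := Finset.univ.filter fun a ↦ ∃ a', a' ≠ a ∧ f a' = f a with hM
  have hMc : {a | ∃ a', a' ≠ a ∧ f a' = f a}.ncard = M.card := by
    rw [← Set.ncard_coe_finset]; simp [hM]
  rw [hMc, Nat.card_eq_fintype_card, Nat.card_eq_fintype_card, ← Finset.card_univ (α := α),
    Finset.card_eq_sum_card_fiberwise (f := f) (s := M) (t := Finset.univ) (by simp),
    Finset.card_eq_sum_card_fiberwise (f := f) (s := Finset.univ) (t := Finset.univ) (by simp),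
    ← Finset.card_univ (α := β), Finset.card_eq_sum_ones, Finset.mul_sum, Finset.mul_sum,
    ← Finset.sum_add_distrib]
  -- Fibrewise the claim is 2 + |M ∩ fibre| ≤ 2|fibre|: a one-point fibre misses `M`, and a larger
  -- one has at least two points.
  refine Finset.sum_le_sum fun b _ ↦ ?_
  have hle : (M.filter fun a ↦ f a = b).card ≤ (Finset.univ.filter fun a ↦ f a = b).card :=
    Finset.card_le_card (Finset.filter_subset_filter _ (Finset.subset_univ M))
  obtain ⟨a, rfl⟩ := hf b
  have hpos : 0 < (Finset.univ.filter fun x ↦ f x = f a).card :=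
    Finset.card_pos.2 ⟨a, by simp⟩
  rcases Finset.eq_empty_or_nonempty (M.filter fun x ↦ f x = f a) with h0 | ⟨x, hx⟩
  · rw [h0]
    simp only [Finset.card_empty]
    omega
  · simp only [hM, Finset.mem_filter, Finset.mem_univ, true_and] at hx
    obtain ⟨⟨y, hyx, hy⟩, hxa⟩ := hx
    have : 1 < (Finset.univ.filter fun x ↦ f x = f a).card :=
      Finset.one_lt_card.2 ⟨x, by simp [hxa], y, by simp [hy, hxa], hyx.symm⟩
    omega

theorem two_mul_numComponents_add_le [Finite V] {A B : Set V} (hA : G.IsTotalDominatingSet A)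
    (h : A ⊆ B) :
    2 * G.numComponents B + (mergedComponents G h).ncard ≤ 2 * G.numComponents A :=
  two_mul_card_add_ncard_le _ (componentMap_surjective hA h)

/-- Otherwise deleting the neighbourhood of `v` would isolate `v` from some remaining vertex. -/
theorem IsVertexConnected.le_ncard_neighborSet [Finite V] {k : ℕ} (hG : G.IsVertexConnected k)
    (v : V) : k ≤ (G.neighborSet v).ncard := by
  by_contra! hlt
  have hconn := hG.2 _ hlt
  have hins : (insert v (G.neighborSet v)).ncard < Nat.card V :=
    ((Set.ncard_insert_le _ _).trans hlt).trans_lt hG.1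
  obtain ⟨x, hx⟩ : ∃ x, x ∉ insert v (G.neighborSet v) := by
    by_contra! hall
    rw [Set.eq_univ_of_forall hall, Set.ncard_univ] at hins
    exact hins.false
  have hv : v ∈ (G.neighborSet v)ᶜ := by simp
  have hx' : x ∈ (G.neighborSet v)ᶜ := fun h ↦ hx (Set.mem_insert_of_mem _ h)
  have hr := hconn.preconnected ⟨v, hv⟩ ⟨x, hx'⟩
  have := hr.closed (P := fun y ↦ (y : V) = v) (by
    rintro ⟨a, ha⟩ ⟨b, hb⟩ hav hab
    replace hab : G.Adj a b := hab
    replace hav : a = v := hav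
    exact absurd (hav ▸ hab) hb) rfl
  exact hx (by simp [show x = v from this])

/-- The vertices outside `A` adjacent both to the component `C` and to the rest of `A`. -/
def shortConnectors {A : Set V} (C : (G.induce A).ConnectedComponent) : Set V :=
  {v | v ∉ A ∧ (∃ c ∈ componentSet C, G.Adj v c) ∧ ∃ c ∈ A, c ∉ componentSet C ∧ G.Adj v c}

/-- A set of disjoint edges `(u, w)` outside `A` such that `C` is the only component adjacent
to `u`, and `w` is not adjacent to `C`. -/
structure IsLongConnectorSet {A : Set V} (C : (G.induce A).ConnectedComponent)
    (M : Finset (V × V)) : Prop where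
  injOn_fst : Set.InjOn Prod.fst (M : Set (V × V))
  injOn_snd : Set.InjOn Prod.snd (M : Set (V × V))
  fst_notMem : ∀ e ∈ M, e.1 ∉ A
  snd_notMem : ∀ e ∈ M, e.2 ∉ A
  adj : ∀ e ∈ M, G.Adj e.1 e.2
  fst_adj : ∀ e ∈ M, ∃ c ∈ componentSet C, G.Adj e.1 c
  fst_only : ∀ e ∈ M, ∀ c ∈ A, G.Adj e.1 c → c ∈ componentSet C
  snd_not_adj : ∀ e ∈ M, ∀ c ∈ componentSet C, ¬ G.Adj e.2 c

theorem IsLongConnectorSet.subset {A : Set V} {C : (G.induce A).ConnectedComponent}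
    {M M' : Finset (V × V)} (h : IsLongConnectorSet C M) (hM : M' ⊆ M) :
    IsLongConnectorSet C M' where
  injOn_fst := h.injOn_fst.mono (by exact_mod_cast hM)
  injOn_snd := h.injOn_snd.mono (by exact_mod_cast hM)
  fst_notMem e he := h.fst_notMem e (hM he)
  snd_notMem e he := h.snd_notMem e (hM he)
  adj e he := h.adj e (hM he)
  fst_adj e he := h.fst_adj e (hM he)
  fst_only e he := h.fst_only e (hM he)
  snd_not_adj e he := h.snd_not_adj e (hM he)

/-- If both kinds of connector were scarce, the short ones together with the ends of a maximum
family of long ones would be fewer than k vertices separating `C` from the rest of `A`. -/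
theorem exists_connectors [Finite V] {k : ℕ} (hG : G.IsVertexConnected k) {A : Set V}
    (C : (G.induce A).ConnectedComponent) (hC : ∃ C', C' ≠ C) :
    k ≤ 2 * (shortConnectors C).ncard ∨ ∃ M, IsLongConnectorSet C M ∧ k ≤ 4 * M.card := by
  classical
  have : Fintype V := Fintype.ofFinite V
  obtain ⟨M, hM, hmax⟩ := Finset.exists_max_image
    (Finset.univ.filter fun M : Finset (V × V) ↦ IsLongConnectorSet C M) Finset.card
    ⟨∅, by simpa using ⟨by simp, by simp, by simp, by simp, by simp, by simp, by simp, by simp⟩⟩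
  simp only [Finset.mem_filter, Finset.mem_univ, true_and] at hM hmax
  by_contra! hcon
  have hMk := hcon.2 M hM
  set T : Set V := shortConnectors C ∪ ((M.image Prod.fst ∪ M.image Prod.snd : Finset V) : Set V)
    with hT
  have hTk : T.ncard < k := by
    have h1 := Set.ncard_union_le (shortConnectors C)
      ((M.image Prod.fst ∪ M.image Prod.snd : Finset V) : Set V)
    rw [Set.ncard_coe_finset] at h1
    have h2 := Finset.card_union_le (M.image Prod.fst) (M.image Prod.snd)
    have h3 : (M.image Prod.fst).card ≤ M.card := Finset.card_image_le
    have h4 : (M.image Prod.snd).card ≤ M.card := Finset.card_image_le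
    have := hcon.1
    rw [← hT] at h1
    omega
  have hTA : ∀ x ∈ A, x ∉ T := by
    rintro x hx (h | h)
    · exact h.1 hx
    · simp only [Finset.coe_union, Finset.coe_image, Set.mem_union, Set.mem_image] at h
      rcases h with ⟨e, he, rfl⟩ | ⟨e, he, rfl⟩
      · exact hM.fst_notMem e he hx
      · exact hM.snd_notMem e he hx
  obtain ⟨C', hC'⟩ := hC
  obtain ⟨c, hc⟩ := componentSet_nonempty C
  obtain ⟨c', hc'⟩ := componentSet_nonempty C'
  have hr := (hG.2 T hTk).preconnected ⟨c, hTA c hc.1⟩ ⟨c', hTA c' hc'.1⟩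
  -- A walk avoiding `T` cannot leave `C` together with the outside vertices whose `A`-neighbours
  -- exist and all lie in `C`: an escaping edge would enlarge the maximum `M`.
  have hend := hr.closed (P := fun y ↦ (y : V) ∈ componentSet C ∨ ((y : V) ∉ A ∧
      (∃ c ∈ componentSet C, G.Adj y c) ∧ ∀ c ∈ A, G.Adj y c → c ∈ componentSet C)) (by
    rintro ⟨x, hx⟩ ⟨y, hy⟩ hPx hxy
    replace hxy : G.Adj x y := hxy
    dsimp only at hPx ⊢
    have hyD : y ∉ A → (∃ c ∈ componentSet C, G.Adj y c) →
        ∀ c ∈ A, G.Adj y c → c ∈ componentSet C := by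
      intro hyA hyC c hcA hyc
      by_contra hcC
      exact hy (Or.inl ⟨hyA, hyC, c, hcA, hcC, hyc⟩)
    by_cases hyA : y ∈ A
    · left
      rcases hPx with hPx | ⟨_, _, hPx⟩
      · exact componentSet_adj hPx hyA hxy
      · exact hPx y hyA hxy
    · right
      by_cases hyC : ∃ c ∈ componentSet C, G.Adj y c
      · exact ⟨hyA, hyC, hyD hyA hyC⟩
      · exfalso
        rcases hPx with hPx | ⟨hxA, hxC, hxo⟩
        · exact hyC ⟨x, hPx, hxy.symm⟩
        push Not at hyC
        have hx1 : ∀ e ∈ M, e.1 ≠ x := by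
          rintro e he rfl
          exact hx (Or.inr (by simpa using Or.inl ⟨e.2, he⟩))
        have hy1 : ∀ e ∈ M, e.2 ≠ y := by
          rintro e he rfl
          exact hy (Or.inr (by simpa using Or.inr ⟨e.1, he⟩))
        have hnot : (x, y) ∉ M := fun h ↦ hx1 _ h rfl
        have hins : IsLongConnectorSet C (insert (x, y) M) := by
          refine ⟨?_, ?_, ?_, ?_, ?_, ?_, ?_, ?_⟩
          · rw [Finset.coe_insert, Set.injOn_insert (by simpa using hnot)]
            exact ⟨hM.injOn_fst, fun ⟨e, he, h⟩ ↦ hx1 e he h⟩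
          · rw [Finset.coe_insert, Set.injOn_insert (by simpa using hnot)]
            exact ⟨hM.injOn_snd, fun ⟨e, he, h⟩ ↦ hy1 e he h⟩
          · exact (Finset.forall_mem_insert _ _ _).2 ⟨hxA, hM.fst_notMem⟩
          · exact (Finset.forall_mem_insert _ _ _).2 ⟨hyA, hM.snd_notMem⟩
          · exact (Finset.forall_mem_insert _ _ _).2 ⟨hxy, hM.adj⟩
          · exact (Finset.forall_mem_insert _ _ _).2 ⟨hxC, hM.fst_adj⟩
          · exact (Finset.forall_mem_insert _ _ _).2 ⟨hxo, hM.fst_only⟩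
          · exact (Finset.forall_mem_insert _ _ _).2 ⟨hyC, hM.snd_not_adj⟩
        have := hmax _ hins
        rw [Finset.card_insert_of_notMem hnot] at this
        omega) (Or.inl hc)
  rcases hend with h | h
  · exact hC' (eq_of_mem_componentSet hc' h)
  · exact h.1 hc'.1

end SimpleGraph

/-! ### The chance that a long connector is realised. -/

section Probability

variable {V ι α β : Type*} [Fintype V] [DecidableEq V] [Fintype ι] [Fintype α] [Fintype β]

theorem pexp_pexp_and (w : α → ℝ) (w' : β → ℝ) (P : (V → β) → Prop) (Q : (V → α) → Prop) :
    pexp w (fun X ↦ pexp w' fun Y ↦ indicatorProp (P Y ∧ Q X)) =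
      pprob w' P * pprob w Q := by
  have h : ∀ X, (pexp w' fun Y ↦ indicatorProp (P Y ∧ Q X)) =
      pprob w' P * indicatorProp (Q X) := by
    intro X
    rw [pprob, ← pexp_mul_const]
    congr 1
    ext Y
    by_cases h1 : P Y <;> by_cases h2 : Q X <;> simp [h1, h2]
  simp only [h]
  rw [pexp_const_mul]
  rfl

/-- The pair term uses the weaker event `Q`, whose pair probabilities factor, while `P` also carries
the no-conflict condition. -/
theorem bonferroni {γ : Type*} (s : Finset γ) (P Q : γ → Prop) (h : ∀ e, P e → Q e) :
    ∑ e ∈ s, indicatorProp (P e) -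
      (1 / 2) * ∑ x ∈ s.offDiag, indicatorProp (Q x.1 ∧ Q x.2) ≤
      indicatorProp (∃ e ∈ s, P e) := by
  classical
  have hP : ∑ e ∈ s, indicatorProp (P e) = (s.filter P).card := by simp [indicatorProp]
  have hQ : ∑ x ∈ s.offDiag, indicatorProp (Q x.1 ∧ Q x.2) =
      ((s.filter Q).card : ℝ) * (s.filter Q).card - (s.filter Q).card := by
    have : s.offDiag.filter (fun x ↦ Q x.1 ∧ Q x.2) = (s.filter Q).offDiag := by
      ext x
      simp only [Finset.mem_filter, Finset.mem_offDiag]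
      tauto
    have hind : ∀ x : γ × γ, indicatorProp (Q x.1 ∧ Q x.2) =
        if Q x.1 ∧ Q x.2 then (1 : ℝ) else 0 := fun x ↦ by
      by_cases hx : Q x.1 ∧ Q x.2 <;> simp [hx]
    simp only [hind]
    rw [← Finset.sum_filter, this, Finset.sum_const, Finset.offDiag_card, nsmul_eq_mul, mul_one,
      Nat.cast_sub (Nat.le_mul_self _), Nat.cast_mul]
  rw [hP, hQ]
  have hle : ((s.filter P).card : ℝ) ≤ (s.filter Q).card := by
    exact_mod_cast Finset.card_le_card (Finset.monotone_filter_right s fun e _ ↦ h e)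
  generalize (s.filter Q).card = g at *
  by_cases hex : ∃ e ∈ s, P e
  · rw [indicatorProp_of_true hex]
    obtain ⟨e, he, hPe⟩ := hex
    have hy : 1 ≤ (s.filter P).card := Finset.card_pos.2 ⟨e, by simp [he, hPe]⟩
    generalize (s.filter P).card = y at *
    have hy' : (1 : ℝ) ≤ y := by exact_mod_cast hy
    -- This is y - y(y-1)/2 ≤ 1 for an integer y ≥ 1; replacing y by g ≥ y in the subtracted term
    -- only helps.
    have h2 : 0 ≤ ((y : ℝ) - 1) * (y - 2) := by
      rcases hy.eq_or_lt with rfl | h2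
      · norm_num
      · have : (2 : ℝ) ≤ y := by exact_mod_cast h2
        exact mul_nonneg (by linarith) (by linarith)
    nlinarith
  · have : s.filter P = ∅ := by
      rw [Finset.filter_eq_empty_iff]
      intro e he hPe
      exact hex ⟨e, he, hPe⟩
    rw [this, indicatorProp_of_not hex]
    have : (g : ℝ) ≤ (g : ℝ) * g := by exact_mod_cast Nat.le_mul_self g
    simp only [Finset.card_empty, Nat.cast_zero]
    linarith

/-- Colour `i` is active at `u` if the partner of `u` for `i` received colour `i`. -/
def IsActiveColour (W : ι → V → Option V) (X : V → Option ι) (u : V) (i : ι) : Prop :=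
  ∃ w, W i u = some w ∧ X w = some i

/-- Each colour j ≠ i conflicts through a single partner, independent of `w`; a union bound over the
colours loses the factor that cancels one denominator. -/
theorem pprob_conflict_le [Nonempty ι] {q : ℝ} (h0 : 0 ≤ q) (h1 : q ≤ 1)
    (W : ι → V → Option V) (u w : V) (i : ι) :
    pprob (colourWeight ι q)
      (fun X : V → Option ι ↦ X w = some i ∧ ∃ j, j ≠ i ∧ IsActiveColour W X u j) ≤
      q * (q / Fintype.card ι) := by
  classical
  have hw := isProbWeight_colourWeight (ι := ι) h0 h1
  have hc : (0 : ℝ) < Fintype.card ι := by exact_mod_cast Fintype.card_pos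
  have hj : ∀ j, pprob (colourWeight ι q)
      (fun X : V → Option ι ↦ j ≠ i ∧ X w = some i ∧ IsActiveColour W X u j) ≤
      (q / Fintype.card ι) * (q / Fintype.card ι) := by
    intro j
    by_cases hji : j ≠ i ∧ ∃ w', W j u = some w' ∧ w ≠ w'
    · obtain ⟨hji, w', hw', hne⟩ := hji
      rw [← pprob_colour_pair h0 h1 hne i j]
      refine pprob_mono hw ?_
      rintro X ⟨-, hX, w'', hw'', hX''⟩
      rw [hw'] at hw''
      exact ⟨hX, by rw [Option.some.inj hw'']; exact hX''⟩
    -- The event is impossible here: j = i, or there is no partner, or the partner is `w`, which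
    -- would need two colours.
    · have : pprob (colourWeight ι q) (fun _ : V → Option ι ↦ False) = 0 := by
        simp [pprob, pexp]
      refine (pprob_mono hw (Q := fun _ ↦ False) ?_).trans (this.trans_le (by positivity))
      rintro X ⟨hne, hX, w', hw', hX'⟩
      refine hji ⟨hne, w', hw', ?_⟩
      rintro rfl
      rw [hX] at hX'
      exact hne (Option.some.inj hX').symm
  calc _ ≤ pprob (colourWeight ι q) (fun X : V → Option ι ↦ ∃ j ∈ Finset.univ,
        j ≠ i ∧ X w = some i ∧ IsActiveColour W X u j) :=
        pprob_mono hw fun X ⟨hX, j, hj, hact⟩ ↦ ⟨j, Finset.mem_univ j, hj, hX, hact⟩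
    _ ≤ ∑ j : ι, (q / Fintype.card ι) * (q / Fintype.card ι) :=
        (pprob_exists_le hw _ _).trans (Finset.sum_le_sum fun j _ ↦ hj j)
    _ = _ := by
        rw [Finset.sum_const, Finset.card_univ, nsmul_eq_mul]
        field_simp

theorem le_pexp_exists_unblocked_edge [Nonempty ι] {q : ℝ} (h0 : 0 ≤ q) (h1 : q ≤ 1 / 2)
    (W : ι → V → Option V) (i : ι) (M : Finset (V × V))
    (hfst : Set.InjOn Prod.fst (M : Set (V × V))) (hsnd : Set.InjOn Prod.snd (M : Set (V × V)))
    (hl : 1 / 4 ≤ M.card * (q * (q / Fintype.card ι)))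
    (hu : M.card * (q * (q / Fintype.card ι)) ≤ 1 / 2) :
    3 / 32 ≤ pexp (colourWeight ι q) fun X : V → Option ι ↦ pexp (coinWeight q) fun Y : V → Prop ↦
      indicatorProp
        (∃ e ∈ M, Y e.1 ∧ X e.2 = some i ∧ ¬ ∃ j, j ≠ i ∧ IsActiveColour W X e.1 j) := by
  have h1' : q ≤ 1 := by linarith
  have hw := isProbWeight_colourWeight (ι := ι) h0 h1'
  have hw' := isProbWeight_coinWeight h0 h1'
  set r := q * (q / Fintype.card ι) with hr
  have hr0 : 0 ≤ r := by positivity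
  have key := pexp_mono hw fun X : V → Option ι ↦ pexp_mono hw' fun Y : V → Prop ↦
    bonferroni M
      (fun e ↦ Y e.1 ∧ X e.2 = some i ∧ ¬ ∃ j, j ≠ i ∧ IsActiveColour W X e.1 j)
      (fun e ↦ Y e.1 ∧ X e.2 = some i) fun e h ↦ ⟨h.1, h.2.1⟩
  refine le_trans ?_ key
  simp only [pexp_sub, pexp_const_mul, pexp_sum]
  have hfirst : ∀ e ∈ M, r * (1 / 2) ≤ pexp (colourWeight ι q) fun X : V → Option ι ↦
      pexp (coinWeight q) fun Y : V → Prop ↦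
      indicatorProp (Y e.1 ∧ X e.2 = some i ∧ ¬ ∃ j, j ≠ i ∧ IsActiveColour W X e.1 j) := by
    intro e _
    rw [pexp_pexp_and (colourWeight ι q) (coinWeight q) (fun Y : V → Prop ↦ Y e.1)
      (fun X ↦ X e.2 = some i ∧ ¬ ∃ j, j ≠ i ∧ IsActiveColour W X e.1 j),
      pprob_coin h0 h1', pprob_and_not, pprob_colour h0 h1']
    have := pprob_conflict_le h0 h1' W e.1 e.2 i
    have h3 : q * r ≤ 1 / 2 * r := mul_le_mul_of_nonneg_right h1 hr0
    have h4 := mul_le_mul_of_nonneg_left this h0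
    rw [mul_sub, ← hr]
    rw [← hr] at h4
    linarith
  have hsecond : ∀ x ∈ M.offDiag, (pexp (colourWeight ι q) fun X : V → Option ι ↦
      pexp (coinWeight q) fun Y : V → Prop ↦
      indicatorProp ((Y x.1.1 ∧ X x.1.2 = some i) ∧ (Y x.2.1 ∧ X x.2.2 = some i)))
      = r * r := by
    intro x hx
    rw [Finset.mem_offDiag] at hx
    have hne1 : x.1.1 ≠ x.2.1 := fun h ↦ hx.2.2 (hfst hx.1 hx.2.1 h)
    have hne2 : x.1.2 ≠ x.2.2 := fun h ↦ hx.2.2 (hsnd hx.1 hx.2.1 h)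
    simp only [and_and_and_comm (b := _ = _)]
    rw [pexp_pexp_and (colourWeight ι q) (coinWeight q) (fun Y : V → Prop ↦ Y x.1.1 ∧ Y x.2.1)
      (fun X ↦ X x.1.2 = some i ∧ X x.2.2 = some i),
      pprob_coin_pair h0 h1' hne1, pprob_colour_pair h0 h1' hne2, hr]
    ring
  rw [Finset.sum_congr rfl hsecond, Finset.sum_const, Finset.offDiag_card, nsmul_eq_mul,
    Nat.cast_sub (Nat.le_mul_self _), Nat.cast_mul]
  have hsum := Finset.sum_le_sum hfirst
  rw [Finset.sum_const, nsmul_eq_mul] at hsum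
  refine le_trans ?_ (sub_le_sub_right hsum _)
  have hm : 0 ≤ (M.card : ℝ) * (r * r) := by positivity
  -- With x = |M|r in [1/4, 1/2], the bound is at least x/2 - x²/2, whose minimum there is 3/32, at
  -- x = 1/4.
  nlinarith [mul_nonneg (sub_nonneg.2 hl) (sub_nonneg.2 hu)]

end Probability

/-! ### Rounds of extension and the decay of the excess. -/

namespace SimpleGraph

variable {V ι : Type*} {G : SimpleGraph V}

/-- One round of extension: coloured vertices join the set of their colour, and vertices of `Y` with
a unique active colour join the set of that colour. -/
def extendFamily (A : ι → Set V) (W : ι → V → Option V) (X : V → Option ι) (Y : V → Prop) (i : ι) :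
    Set V :=
  {v | v ∈ A i ∨ X v = some i ∨
    (Y v ∧ IsActiveColour W X v i ∧ ¬ ∃ j, j ≠ i ∧ IsActiveColour W X v j)}

theorem subset_extendFamily (A : ι → Set V) (W : ι → V → Option V) (X : V → Option ι)
    (Y : V → Prop) (i : ι) : A i ⊆ extendFamily A W X Y i := fun _ h ↦ Or.inl h

theorem extendFamily_subset (A : ι → Set V) (W : ι → V → Option V) (X : V → Option ι)
    (Y : V → Prop) (i : ι) :
    extendFamily A W X Y i ⊆ A i ∪ {v | (X v).isSome ∨ Y v} := by
  rintro v (h | h | h)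
  · exact Or.inl h
  · exact Or.inr (Or.inl (by simp [h]))
  · exact Or.inr (Or.inr h.1)

/-- At most one set through the vertex's own colour, and one through a unique active colour. -/
theorem ncard_new_extendFamily_le [Finite ι] (A : ι → Set V) (W : ι → V → Option V) (X : V → Option ι)
    (Y : V → Prop) (v : V) :
    {i | v ∈ extendFamily A W X Y i ∧ v ∉ A i}.ncard ≤ 2 := by
  have hsub : {i | v ∈ extendFamily A W X Y i ∧ v ∉ A i} ⊆ {i | X v = some i} ∪
      {i | IsActiveColour W X v i ∧ ¬ ∃ j, j ≠ i ∧ IsActiveColour W X v j} := by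
    rintro i ⟨h | h | h, hA⟩
    · exact absurd h hA
    · exact Or.inl h
    · exact Or.inr h.2
  have h1 : {i | X v = some i}.ncard ≤ 1 := by
    rw [Set.ncard_le_one]
    intro i hi j hj
    exact Option.some.inj (hi.symm.trans hj)
  have h2 : {i | IsActiveColour W X v i ∧ ¬ ∃ j, j ≠ i ∧ IsActiveColour W X v j}.ncard ≤ 1 := by
    rw [Set.ncard_le_one]
    intro i hi j hj
    by_contra hne
    exact hi.2 ⟨j, fun h ↦ hne h.symm, hj.1⟩
  exact (Set.ncard_le_ncard hsub).trans ((Set.ncard_union_le _ _).trans (add_le_add h1 h2))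

theorem numComponents_pos [Finite V] {A : Set V} (hA : A.Nonempty) : 0 < G.numComponents A := by
  obtain ⟨v, hv⟩ := hA
  have : Nonempty (G.induce A).ConnectedComponent :=
    ⟨(G.induce A).connectedComponentMk ⟨v, hv⟩⟩
  exact Nat.card_pos

open Classical in
/-- The partner of `u` in the long connectors of the unique component of the `i`-th set to which
`u` belongs. -/
noncomputable def partner {A : ι → Set V}
    (L : ∀ i, (G.induce (A i)).ConnectedComponent → Finset (V × V)) (i : ι) (u : V) : Option V :=
  if h : ∃ w C, (u, w) ∈ L i C then some h.choose else none

/-- The first end of a long connector touches only one component of `A i`, so that component, and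
hence the partner, is determined by the vertex and the colour alone. -/
theorem partner_eq {A : ι → Set V}
    {L : ∀ i, (G.induce (A i)).ConnectedComponent → Finset (V × V)}
    (hL : ∀ i C, IsLongConnectorSet C (L i C)) {i : ι} {C : (G.induce (A i)).ConnectedComponent}
    {e : V × V} (he : e ∈ L i C) : partner L i e.1 = some e.2 := by
  have hex : ∃ w C, (e.1, w) ∈ L i C := ⟨e.2, C, he⟩
  rw [partner, dif_pos hex]
  obtain ⟨C', hC'⟩ := hex.choose_spec
  obtain ⟨c, hc, hec⟩ := (hL i C).fst_adj e he
  have hCC : C = C' := eq_of_mem_componentSet hc ((hL i C').fst_only _ hC' c hc.1 hec)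
  subst hCC
  exact congrArg (fun x ↦ some x.2) ((hL i C).injOn_fst hC' he rfl)

/-- The sets `A i` can be enlarged, by vertices of `S`, to sets inducing connected subgraphs, with
every vertex added to at most `r` of the sets. -/
def HasConnectedExtension (G : SimpleGraph V) (A : ι → Set V) (S : Set V) (r : ℕ) : Prop :=
  ∃ τ : ι → Set V, (∀ i, A i ⊆ τ i) ∧ (∀ i, τ i ⊆ A i ∪ S) ∧
    (∀ i, (G.induce (τ i)).Connected) ∧ ∀ v, {i | v ∈ τ i ∧ v ∉ A i}.ncard ≤ r

theorem HasConnectedExtension.of_round [Finite ι] {A B : ι → Set V} {S T : Set V} {r s : ℕ}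
    (h : G.HasConnectedExtension B T r) (hAB : ∀ i, A i ⊆ B i) (hBS : ∀ i, B i ⊆ A i ∪ S)
    (hTS : T ⊆ S) (hs : ∀ v, {i | v ∈ B i ∧ v ∉ A i}.ncard ≤ s) :
    G.HasConnectedExtension A S (r + s) := by
  obtain ⟨τ, hBτ, hτ, hconn, hr⟩ := h
  refine ⟨τ, fun i ↦ (hAB i).trans (hBτ i), fun i ↦ (hτ i).trans
    (Set.union_subset (hBS i) (hTS.trans Set.subset_union_right)), hconn, fun v ↦ ?_⟩
  have hsub : {i | v ∈ τ i ∧ v ∉ A i} ⊆ {i | v ∈ τ i ∧ v ∉ B i} ∪ {i | v ∈ B i ∧ v ∉ A i} := by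
    rintro i ⟨h1, h2⟩
    by_cases h : v ∈ B i
    · exact Or.inr ⟨h, h2⟩
    · exact Or.inl ⟨h1, h⟩
  exact (Set.ncard_le_ncard hsub).trans ((Set.ncard_union_le _ _).trans (add_le_add (hr v) (hs v)))

variable [Fintype V] [DecidableEq V] [Fintype ι]

/-- The total number of components in excess of one in a family of vertex sets. -/
noncomputable def excess (G : SimpleGraph V) (A : ι → Set V) : ℝ :=
  ∑ i, ((G.numComponents (A i) : ℝ) - 1)

/-- With k/2 short connectors, all miss colour i with probability at most 1/e, and `Y` plays no
role; otherwise a long connector with no conflict does the merging. -/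
theorem le_pexp_merged [Nonempty ι] {q : ℝ} (h0 : 0 ≤ q) (h1 : q ≤ 1 / 2) {k : ℕ}
    {A : ι → Set V} (hA : ∀ i, G.IsTotalDominatingSet (A i))
    {L : ∀ i, (G.induce (A i)).ConnectedComponent → Finset (V × V)}
    (hL : ∀ i C, IsLongConnectorSet C (L i C)) {i : ι} {C : (G.induce (A i)).ConnectedComponent}
    (hkq : 2 ≤ k * (q / Fintype.card ι))
    (hC : k ≤ 2 * (shortConnectors C).ncard ∨
      (1 / 4 ≤ (L i C).card * (q * (q / Fintype.card ι)) ∧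
        (L i C).card * (q * (q / Fintype.card ι)) ≤ 1 / 2)) :
    3 / 32 ≤ pexp (colourWeight ι q) fun X : V → Option ι ↦ pexp (coinWeight q) fun Y : V → Prop ↦
      indicatorProp (C ∈ mergedComponents G (subset_extendFamily A (partner L) X Y i)) := by
  have h1' : q ≤ 1 := by linarith
  have hw := isProbWeight_colourWeight (ι := ι) h0 h1'
  have hw' := isProbWeight_coinWeight h0 h1'
  rcases hC with hC | ⟨hl, hu⟩
  · set B := (Set.toFinite (shortConnectors C)).toFinset with hB
    have hBc : B.card = (shortConnectors C).ncard := by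
      rw [← Set.ncard_eq_toFinset_card _ _]
    have hprob : 3 / 32 ≤ pprob (colourWeight ι q)
        (fun X : V → Option ι ↦ ¬ ∀ v ∈ B, X v ≠ some i) := by
      rw [pprob_not hw, pprob_colour_avoid h0 h1']
      have hB2 : (k : ℝ) ≤ 2 * B.card := by rw [hBc]; exact_mod_cast hC
      have hr0 : 0 ≤ q / Fintype.card ι := by positivity
      have hr1 : q / Fintype.card ι ≤ 1 :=
        (div_le_self h0 (by exact_mod_cast Fintype.card_pos)).trans h1'
      have hmul : 1 ≤ B.card * (q / Fintype.card ι) := by nlinarith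
      have h2 : (1 - q / Fintype.card ι) ^ B.card ≤ Real.exp (-1) := by
        calc (1 - q / Fintype.card ι) ^ B.card ≤ Real.exp (-(q / Fintype.card ι)) ^ B.card :=
              pow_le_pow_left₀ (by linarith) (Real.one_sub_le_exp_neg _) _
          _ = Real.exp (-(B.card * (q / Fintype.card ι))) := by
              rw [← Real.exp_nat_mul]; ring_nf
          _ ≤ _ := Real.exp_le_exp.2 (by linarith)
      have h3 := Real.exp_neg_one_lt_half
      linarith
    refine hprob.trans (pexp_mono hw fun X ↦ ?_)
    rw [← pexp_const hw' (V := V) (indicatorProp (¬ ∀ v ∈ B, X v ≠ some i))]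
    refine pexp_mono hw' fun Y ↦ ?_
    by_cases hX : ∀ v ∈ B, X v ≠ some i
    · rw [indicatorProp_of_not (by simpa using hX)]
      exact indicatorProp_nonneg _
    · refine indicatorProp_mono fun _ ↦ ?_
      push Not at hX
      obtain ⟨x, hxB, hx⟩ := hX
      simp only [hB, Set.Finite.mem_toFinset] at hxB
      obtain ⟨-, ⟨c, hc, hxc⟩, c', hc', hcc', hxc'⟩ := hxB
      exact mem_mergedComponents_of_common_neighbor _ (Or.inr (Or.inl hx)) hc hc' hcc' hxc hxc'
  · refine (le_pexp_exists_unblocked_edge h0 h1 (partner L) i (L i C) (hL i C).injOn_fst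
      (hL i C).injOn_snd hl hu).trans (pexp_mono hw fun X ↦ pexp_mono hw' fun Y ↦ ?_)
    refine indicatorProp_mono fun ⟨e, he, hY, hX, hcf⟩ ↦ ?_
    obtain ⟨c, hc, huc⟩ := (hL i C).fst_adj e he
    obtain ⟨c', hc', hwc'⟩ := hA i e.2
    exact mem_mergedComponents_of_adj _
      (Or.inr (Or.inr ⟨hY, ⟨e.2, partner_eq hL he, hX⟩, hcf⟩)) (Or.inr (Or.inl hX)) hc hc'
      (fun h ↦ (hL i C).snd_not_adj e he c' h hwc') huc ((hL i C).adj e he) hwc'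

/-- Merged components at least halve in number, so a merging chance of 3/32 removes 3/64 of the
components on average. Long connector sets are trimmed to exactly `m` edges to keep the Bonferroni
pair term small. -/
theorem exists_extension_round [Nonempty V] [Nonempty ι] {q : ℝ} (h0 : 0 ≤ q) (h1 : q ≤ 1 / 2)
    {k m : ℕ} (hG : G.IsVertexConnected k) (hkq : 2 ≤ k * (q / Fintype.card ι)) (hmk : 4 * m ≤ k)
    (hl : 1 / 4 ≤ m * (q * (q / Fintype.card ι))) (hu : m * (q * (q / Fintype.card ι)) ≤ 1 / 2)
    {A : ι → Set V} (hA : ∀ i, G.IsTotalDominatingSet (A i)) :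
    ∃ T : (V → Option ι) → (V → Prop) → ι → Set V,
      (∀ X Y i, A i ⊆ T X Y i) ∧ (∀ X Y i, T X Y i ⊆ A i ∪ {v | (X v).isSome ∨ Y v}) ∧
      (∀ X Y v, {i | v ∈ T X Y i ∧ v ∉ A i}.ncard ≤ 2) ∧
      pexp (colourWeight ι q) (fun X ↦ pexp (coinWeight q) fun Y ↦ G.excess (T X Y)) ≤
        31 / 32 * G.excess A := by
  classical
  have h1' : q ≤ 1 := by linarith
  have hw := isProbWeight_colourWeight (ι := ι) h0 h1'
  have hw' := isProbWeight_coinWeight h0 h1'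
  have hex : ∀ i (C : (G.induce (A i)).ConnectedComponent), ∃ M, IsLongConnectorSet C M ∧
      ((∃ C', C' ≠ C) → k ≤ 2 * (shortConnectors C).ncard ∨ M.card = m) := by
    intro i C
    by_cases hC : ∃ C', C' ≠ C
    · rcases exists_connectors hG C hC with h | ⟨M, hM, hk⟩
      · exact ⟨∅, ⟨by simp, by simp, by simp, by simp, by simp, by simp, by simp, by simp⟩,
          fun _ ↦ Or.inl h⟩
      · obtain ⟨M', hM', hc⟩ := Finset.exists_subset_card_eq (show m ≤ M.card by omega)
        exact ⟨M', hM.subset hM', fun _ ↦ Or.inr hc⟩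
    · exact ⟨∅, ⟨by simp, by simp, by simp, by simp, by simp, by simp, by simp, by simp⟩,
        fun h ↦ absurd h hC⟩
  choose L hL hLc using hex
  refine ⟨extendFamily A (partner L), subset_extendFamily A _, extendFamily_subset A _,
    ncard_new_extendFamily_le A _, ?_⟩
  simp only [excess, pexp_sum, Finset.mul_sum]
  refine Finset.sum_le_sum fun i _ ↦ ?_
  simp only [pexp_sub, pexp_const hw', pexp_const hw]
  have hpos : 0 < G.numComponents (A i) := by
    obtain ⟨v⟩ := ‹Nonempty V›
    obtain ⟨u, hu, -⟩ := hA i v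
    exact numComponents_pos ⟨u, hu⟩
  have hcomp : ∀ X Y, (G.numComponents (extendFamily A (partner L) X Y i) : ℝ) ≤
      G.numComponents (A i) -
        1 / 2 * (mergedComponents G (subset_extendFamily A (partner L) X Y i)).ncard := by
    intro X Y
    have := two_mul_numComponents_add_le (hA i) (subset_extendFamily A (partner L) X Y i)
    have h' : (2 * G.numComponents (extendFamily A (partner L) X Y i) +
      (mergedComponents G (subset_extendFamily A (partner L) X Y i)).ncard : ℝ) ≤
        2 * G.numComponents (A i) := by exact_mod_cast this
    linarith
  have hE := pexp_mono hw fun X ↦ pexp_mono hw' fun Y ↦ hcomp X Y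
  simp only [pexp_sub, pexp_const_mul, pexp_const hw', pexp_const hw] at hE
  -- A set that is already connected has excess 0 and stays connected; connectors exist only when
  -- there are two components.
  rcases (Nat.succ_le_of_lt hpos).eq_or_lt with hone | htwo
  · have : 0 ≤ pexp (colourWeight ι q) fun X : V → Option ι ↦ pexp (coinWeight q) fun Y ↦
        ((mergedComponents G (subset_extendFamily A (partner L) X Y i)).ncard : ℝ) :=
      pexp_nonneg hw fun X ↦ pexp_nonneg hw' fun Y ↦ by positivity
    rw [← hone] at hE ⊢
    norm_num at hE ⊢
    linarith
  · have hmerged : 3 / 32 * (G.numComponents (A i) : ℝ) ≤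
        pexp (colourWeight ι q) fun X : V → Option ι ↦ pexp (coinWeight q) fun Y ↦
          ((mergedComponents G (subset_extendFamily A (partner L) X Y i)).ncard : ℝ) := by
      have : Fintype (G.induce (A i)).ConnectedComponent := Fintype.ofFinite _
      have hcard : ∀ X Y,
          ((mergedComponents G (subset_extendFamily A (partner L) X Y i)).ncard : ℝ) =
          ∑ C, indicatorProp
            (C ∈ mergedComponents G (subset_extendFamily A (partner L) X Y i)) := by
        intro X Y
        simp only [indicatorProp]
        rw [Finset.sum_boole, ← Set.ncard_coe_finset]
        simp
      simp only [hcard, pexp_sum]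
      have hsum : ∑ C : (G.induce (A i)).ConnectedComponent, (3 / 32 : ℝ) =
          3 / 32 * (G.numComponents (A i) : ℝ) := by
        rw [Finset.sum_const, nsmul_eq_mul, Finset.card_univ, numComponents,
          Nat.card_eq_fintype_card, mul_comm]
      rw [← hsum]
      refine Finset.sum_le_sum fun C _ ↦ ?_
      have hother : ∃ C', C' ≠ C := by
        have : 1 < Fintype.card (G.induce (A i)).ConnectedComponent := by
          rw [← Nat.card_eq_fintype_card]; exact htwo
        have := Fintype.one_lt_card_iff_nontrivial.1 this
        exact exists_ne C
      refine le_pexp_merged h0 h1 hA hL hkq ((hLc i C hother).imp_right fun h ↦ ?_)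
      rw [h]
      exact ⟨hl, hu⟩
    have h2 : (2 : ℝ) ≤ G.numComponents (A i) := by exact_mod_cast htwo
    linarith

/-- Peels one sample of density q off a sample of density p; the remainder still has room for n
more. -/
theorem one_sub_div_split {p q : ℝ} {n : ℕ} (hq : q < 1) (hp : p ≤ 1)
    (h0 : 0 ≤ q) (h : 1 - p ≤ (1 - q) ^ (n + 1)) :
    ∃ p', 0 ≤ p' ∧ p' ≤ 1 ∧ 1 - p = (1 - q) * (1 - p') ∧ 1 - p' ≤ (1 - q) ^ n := by
  have hq' : 0 < 1 - q := by linarith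
  have hle : (1 - p) / (1 - q) ≤ (1 - q) ^ n := by
    rw [div_le_iff₀ hq', ← pow_succ]
    exact h
  have hone : (1 - q) ^ n ≤ 1 := pow_le_one₀ hq'.le (by linarith)
  have hnn : 0 ≤ (1 - p) / (1 - q) := div_nonneg (by linarith) hq'.le
  refine ⟨1 - (1 - p) / (1 - q), by linarith, by linarith, ?_, by linarith⟩
  field_simp
  ring

/-- Markov's inequality run through the induction: conditioned on one round, the remaining failure
probability is bounded by the new excess, which shrinks in expectation. -/
theorem pprob_not_hasConnectedExtension_le [Nonempty V] [Nonempty ι] {q : ℝ} (h0 : 0 ≤ q)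
    (h1 : q ≤ 1 / 2) {k m : ℕ} (hG : G.IsVertexConnected k)
    (hkq : 2 ≤ k * (q / Fintype.card ι)) (hmk : 4 * m ≤ k)
    (hl : 1 / 4 ≤ m * (q * (q / Fintype.card ι))) (hu : m * (q * (q / Fintype.card ι)) ≤ 1 / 2)
    (R : ℕ) : ∀ (p : ℝ), 0 ≤ p → p ≤ 1 → 1 - p ≤ (1 - q) ^ (2 * R) →
    ∀ A : ι → Set V, (∀ i, G.IsTotalDominatingSet (A i)) →
    pprob (coinWeight p) (fun S : V → Prop ↦ ¬ G.HasConnectedExtension A {v | S v} (2 * R)) ≤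
      (31 / 32) ^ R * G.excess A := by
  classical
  have h1' : q ≤ 1 := by linarith
  have hw := isProbWeight_colourWeight (ι := ι) h0 h1'
  have hw' := isProbWeight_coinWeight h0 h1'
  have hcomp : ∀ A : ι → Set V, (∀ i, G.IsTotalDominatingSet (A i)) →
      ∀ i, 1 ≤ G.numComponents (A i) := by
    intro A hA i
    obtain ⟨v⟩ := ‹Nonempty V›
    obtain ⟨u, hu, -⟩ := hA i v
    exact numComponents_pos ⟨u, hu⟩
  induction R with
  | zero =>
    intro p hp0 hp1 _ A hA
    have hwp := isProbWeight_coinWeight hp0 hp1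
    have hc := hcomp A hA
    -- With no rounds left, either all sets are connected, or the excess is at least 1 and the bound
    -- is trivial.
    by_cases hall : ∀ i, G.numComponents (A i) = 1
    · have hext : ∀ S : V → Prop, G.HasConnectedExtension A {v | S v} (2 * 0) := by
        refine fun S ↦ ⟨A, fun i ↦ subset_rfl, fun i ↦ Set.subset_union_left, fun i ↦ ?_, ?_⟩
        · have hcard := Nat.card_eq_one_iff_unique.1 (hall i)
          obtain ⟨hsub, ⟨C⟩⟩ := hcard
          obtain ⟨v, hv⟩ := componentSet_nonempty C
          have : Nonempty (A i) := ⟨⟨v, hv.1⟩⟩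
          exact ⟨fun x y ↦ ConnectedComponent.exact (Subsingleton.elim _ _)⟩
        · intro v
          simp
      have : pprob (coinWeight p)
          (fun S : V → Prop ↦ ¬ G.HasConnectedExtension A {v | S v} (2 * 0)) = 0 := by
        have : ∀ S : V → Prop,
            indicatorProp (¬ G.HasConnectedExtension A {v | S v} (2 * 0)) = 0 :=
          fun S ↦ indicatorProp_of_not (not_not.2 (hext S))
        simp only [pprob, this, pexp_const hwp]
      rw [this, pow_zero, one_mul]
      exact Finset.sum_nonneg fun i _ ↦ sub_nonneg.2 (by exact_mod_cast hc i)
    · push Not at hall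
      obtain ⟨i, hi⟩ := hall
      refine (pprob_le_one hwp _).trans ?_
      rw [pow_zero, one_mul]
      have h2 : (2 : ℝ) ≤ G.numComponents (A i) := by
        have := hc i
        exact_mod_cast (show 2 ≤ G.numComponents (A i) by omega)
      have := Finset.single_le_sum (f := fun i ↦ (G.numComponents (A i) : ℝ) - 1)
        (fun i _ ↦ sub_nonneg.2 (by exact_mod_cast hc i)) (Finset.mem_univ i)
      rw [excess]
      linarith
  | succ R ih =>
    intro p hp0 hp1 hp A hA
    obtain ⟨p₁, hp₁0, hp₁1, hpp₁, hp₁⟩ := one_sub_div_split (n := 2 * R + 1) (by linarith) hp1 h0 hp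
    obtain ⟨p₂, hp₂0, hp₂1, hpp₂, hp₂⟩ := one_sub_div_split (n := 2 * R) (by linarith) hp₁1 h0 hp₁
    obtain ⟨T, hAT, hTA, hT2, hTE⟩ := exists_extension_round h0 h1 hG hkq hmk hl hu hA
    rw [pprob, pexp_coinWeight_split_colour (ι := ι) hpp₁]
    have hstep : ∀ X : V → Option ι, (pexp (coinWeight p₁) fun Z : V → Prop ↦
        indicatorProp
          (¬ G.HasConnectedExtension A {v | (X v).isSome ∨ Z v} (2 * (R + 1)))) ≤
        pexp (coinWeight q) fun Y ↦ (31 / 32) ^ R * G.excess (T X Y) := by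
      intro X
      rw [pexp_coinWeight_split hpp₂ fun Z ↦
        indicatorProp (¬ G.HasConnectedExtension A {v | (X v).isSome ∨ Z v} (2 * (R + 1)))]
      refine pexp_mono hw' fun Y ↦ ?_
      refine le_trans ?_ (ih p₂ hp₂0 hp₂1 hp₂ (T X Y) fun i ↦ (hA i).mono (hAT X Y i))
      refine pexp_mono (isProbWeight_coinWeight hp₂0 hp₂1) fun Z ↦
        indicatorProp_mono fun hZ hext ↦ hZ ?_
      refine hext.of_round (hAT X Y) (fun i ↦ (hTA X Y i).trans ?_) (fun v hv ↦ Or.inr (Or.inr hv))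
        (hT2 X Y)
      refine Set.union_subset_union_right _ ?_
      rintro v (h | h)
      · exact Or.inl h
      · exact Or.inr (Or.inl h)
    refine (pexp_mono hw hstep).trans ?_
    simp only [pexp_const_mul]
    calc _ ≤ (31 / 32 : ℝ) ^ R * (31 / 32 * G.excess A) :=
          mul_le_mul_of_nonneg_left hTE (by positivity)
      _ = _ := by ring

/-! ### From a dominating family to packings and vertex connectivity. -/

section Induce

variable {V : Type*} {G : SimpleGraph V}

theorem IsTotalDominatingSet.connected_induce {A B : Set V} (hA : G.IsTotalDominatingSet A)
    (hc : (G.induce A).Connected) (h : A ⊆ B) : (G.induce B).Connected := by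
  rw [connected_iff_exists_forall_reachable]
  obtain ⟨a⟩ := hc.nonempty
  refine ⟨⟨a, h a.2⟩, fun w ↦ ?_⟩
  obtain ⟨u, hu, hwu⟩ := hA w
  have h1 := (hc.preconnected a ⟨u, hu⟩).map (G.induceHomOfLE h).toHom
  have h2 : (G.induce B).Adj ⟨u, h hu⟩ w := hwu.symm
  exact h1.trans h2.reachable

theorem connected_induce_induce {S D : Set V} (hDS : D ⊆ S) (h : (G.induce D).Connected) :
    ((G.induce S).induce {x : S | (x : V) ∈ D}).Connected := by
  let f : G.induce D →g (G.induce S).induce {x : S | (x : V) ∈ D} :=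
    ⟨fun x ↦ ⟨⟨x, hDS x.2⟩, x.2⟩, fun h ↦ h⟩
  exact h.map f fun x ↦ ⟨⟨x.1.1, x.2⟩, rfl⟩

end Induce

section Packing

variable {V ι : Type*} {G : SimpleGraph V}

theorem exists_cdsPacking_of_family [Finite V] [Fintype ι] {N : ℕ} (hN : 0 < N) (τ : ι → Set V)
    (hτ : ∀ i, G.IsCDS (τ i)) (hload : ∀ v, {i | v ∈ τ i}.ncard ≤ N) :
    ∃ P : G.CDSPacking, P.size = Fintype.card ι / N := by
  classical
  have : Fintype {τ : Set V // G.IsCDS τ} := Fintype.ofFinite _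
  let f : ι → {τ : Set V // G.IsCDS τ} := fun i ↦ ⟨τ i, hτ i⟩
  refine ⟨⟨fun D ↦ (Finset.univ.filter fun i ↦ f i = D).card / N, fun D ↦ by positivity,
    fun v ↦ ?_⟩, ?_⟩
  · rw [finsum_eq_sum_of_fintype]
    simp only [finsum_eq_if, ← Finset.sum_filter, ← Finset.sum_div]
    rw [div_le_one (by exact_mod_cast hN), ← Nat.cast_sum]
    have h := Finset.card_eq_sum_card_fiberwise (f := f)
      (s := Finset.univ.filter fun i ↦ v ∈ τ i)
      (t := Finset.univ.filter fun D : {τ : Set V // G.IsCDS τ} ↦ v ∈ D.1)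
      (by intro i hi; simpa [f] using hi)
    have hsum : ∑ D ∈ Finset.univ.filter fun D : {τ : Set V // G.IsCDS τ} ↦ v ∈ D.1,
        (Finset.univ.filter fun i ↦ f i = D).card = (Finset.univ.filter fun i ↦ v ∈ τ i).card := by
      rw [h]
      refine Finset.sum_congr rfl fun D hD ↦ congrArg Finset.card ?_
      ext i
      simp only [Finset.mem_filter, Finset.mem_univ, true_and] at hD ⊢
      refine ⟨fun hi ↦ ⟨?_, hi⟩, fun hi ↦ hi.2⟩
      rw [← hi] at hD
      exact hD
    rw [hsum]
    have := hload v
    rw [← Set.ncard_coe_finset]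
    simpa using this
  · rw [CDSPacking.size, finsum_eq_sum_of_fintype, ← Finset.sum_div, ← Nat.cast_sum,
      ← Finset.card_eq_sum_card_fiberwise (by simp), Finset.card_univ]

theorem exists_disjoint_of_load [Finite V] [Finite ι] {N : ℕ} (τ : ι → Set V)
    (hload : ∀ v, {i | v ∈ τ i}.ncard ≤ N) (T : Set V) (hT : N * T.ncard < Nat.card ι) :
    ∃ i, ∀ v ∈ T, v ∉ τ i := by
  classical
  have : Fintype ι := Fintype.ofFinite ι
  by_contra! hcon
  set F := (Set.toFinite T).toFinset
  have hle : (Finset.univ : Finset ι) ⊆ F.biUnion fun v ↦ Finset.univ.filter fun i ↦ v ∈ τ i := by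
    intro i _
    obtain ⟨v, hv, hi⟩ := hcon i
    simp only [Finset.mem_biUnion, Finset.mem_filter, Finset.mem_univ, true_and]
    exact ⟨v, by simpa [F] using hv, hi⟩
  have h1 := (Finset.card_le_card hle).trans (Finset.card_biUnion_le_card_mul F _ N fun v _ ↦ by
    have := hload v
    rw [← Set.ncard_coe_finset]
    simpa using this)
  rw [Finset.card_univ, ← Nat.card_eq_fintype_card, ← Set.ncard_eq_toFinset_card _ _,
    mul_comm] at h1
  omega

/-- A deleted set that is too small misses some `τ i`, which connects the remainder. The factor 2
leaves slack so that the rounded-up bound stays below the number of vertices. -/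
theorem div_le_vertexConnectivity_of_family [Finite V] [Finite ι] [Nonempty ι] {N : ℕ} (hN : 0 < N)
    (τ : ι → Set V) (hdom : ∀ i, G.IsTotalDominatingSet (τ i))
    (hconn : ∀ i, (G.induce (τ i)).Connected) (hload : ∀ v, {i | v ∈ τ i}.ncard ≤ N) :
    (Nat.card ι : ℝ) / (2 * N) ≤ G.vertexConnectivity := by
  have hN' : (0 : ℝ) < N := by exact_mod_cast hN
  have hcard : Nat.card ι ≤ N * Nat.card V := by
    by_contra! hlt
    rw [← Set.ncard_univ] at hlt
    obtain ⟨i, hi⟩ := exists_disjoint_of_load τ hload Set.univ hlt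
    obtain ⟨v⟩ := (hconn i).nonempty
    exact hi v (Set.mem_univ _) v.2
  have htwo : 2 ≤ Nat.card V := by
    obtain ⟨i⟩ := ‹Nonempty ι›
    obtain ⟨v⟩ := (hconn i).nonempty
    obtain ⟨u, -, hu⟩ := hdom i v
    have : Nontrivial V := ⟨v, u, hu.ne⟩
    exact Finite.one_lt_card
  have hm : G.IsVertexConnected ⌈(Nat.card ι : ℝ) / (2 * N)⌉₊ := by
    constructor
    · have h1 : (Nat.card ι : ℝ) / (2 * N) ≤ Nat.card V / 2 := by
        rw [div_le_div_iff₀ (by positivity) (by norm_num)]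
        have : (Nat.card ι : ℝ) ≤ N * Nat.card V := by exact_mod_cast hcard
        linarith
      have h2 : (2 : ℝ) ≤ Nat.card V := by exact_mod_cast htwo
      have h3 := Nat.ceil_lt_add_one (a := (Nat.card ι : ℝ) / (2 * N)) (by positivity)
      have h4 : (⌈(Nat.card ι : ℝ) / (2 * N)⌉₊ : ℝ) < Nat.card V := by linarith
      exact_mod_cast h4
    · intro T hT
      rw [Nat.lt_ceil, lt_div_iff₀ (by positivity)] at hT
      have h1 : (N * T.ncard : ℝ) < Nat.card ι := by
        have : (0 : ℝ) ≤ T.ncard * N := by positivity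
        linarith
      obtain ⟨i, hi⟩ := exists_disjoint_of_load τ hload T (by exact_mod_cast h1)
      exact (hdom i).connected_induce (hconn i) fun v hv hvT ↦ hi v hvT hv
  refine (Nat.le_ceil _).trans ?_
  have hb : BddAbove {k | G.IsVertexConnected k} := ⟨Nat.card V, fun k hk ↦ hk.1.le⟩
  exact_mod_cast le_csSup hb hm

/-- There are connected subsets of `S`, indexed by `ι`, in which every vertex of `G` has a
neighbour, and of which at most `N` contain any given vertex. -/
def HasDominatingFamily (ι : Type*) (G : SimpleGraph V) (S : Set V) (N : ℕ) : Prop :=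
  ∃ τ : ι → Set V, (∀ i, τ i ⊆ S) ∧ (∀ i, G.IsTotalDominatingSet (τ i)) ∧
    (∀ i, (G.induce (τ i)).Connected) ∧ ∀ v, {i | v ∈ τ i}.ncard ≤ N

theorem HasDominatingFamily.packing_and_connectivity [Finite V] [Fintype ι] [Nonempty ι] {S : Set V} {N : ℕ}
    (hN : 0 < N) (h : HasDominatingFamily ι G S N) :
    (∃ P : (G.induce S).CDSPacking, P.size = Fintype.card ι / N) ∧
      (Fintype.card ι : ℝ) / (2 * N) ≤ (G.induce S).vertexConnectivity := by
  obtain ⟨τ, hS, hdom, hconn, hload⟩ := h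
  have hconn' := fun i ↦ connected_induce_induce (hS i) (hconn i)
  have hdom' : ∀ i, (G.induce S).IsTotalDominatingSet {x : S | (x : V) ∈ τ i} := by
    intro i v
    obtain ⟨u, hu, hvu⟩ := hdom i v
    exact ⟨⟨u, hS i hu⟩, hu, hvu⟩
  constructor
  · exact exists_cdsPacking_of_family hN (fun i ↦ {x : S | (x : V) ∈ τ i})
      (fun i ↦ ⟨fun v _ ↦ hdom' i v, hconn' i⟩) fun v ↦ hload v
  · rw [← Nat.card_eq_fintype_card]
    exact div_le_vertexConnectivity_of_family hN (fun i ↦ {x : S | (x : V) ∈ τ i}) hdom' hconn'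
      fun v ↦ hload v

theorem excess_le [Fintype V] [Fintype ι] (G : SimpleGraph V) (A : ι → Set V) :
    G.excess A ≤ Fintype.card ι * Fintype.card V := by
  have h : ∀ i, (G.numComponents (A i) : ℝ) - 1 ≤ Fintype.card V := by
    intro i
    have h1 : G.numComponents (A i) ≤ Nat.card (A i) :=
      Nat.card_le_card_of_surjective _ Quot.mk_surjective
    have h2 : Nat.card (A i) ≤ Nat.card V := Finite.card_subtype_le _
    rw [Nat.card_eq_fintype_card (α := V)] at h2
    have : (G.numComponents (A i) : ℝ) ≤ Fintype.card V := by exact_mod_cast h1.trans h2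
    linarith
  refine (Finset.sum_le_sum fun i _ ↦ h i).trans_eq ?_
  rw [Finset.sum_const, nsmul_eq_mul, Finset.card_univ]

end Packing

/-! ### The initial colour classes and the failure bound. -/

section Sampling

variable {V ι : Type*} [Fintype V] [DecidableEq V] [Fintype ι] {G : SimpleGraph V}

theorem pprob_not_isTotalDominatingSet_le [Nonempty ι] {q : ℝ} (h0 : 0 ≤ q) (h1 : q ≤ 1) {k : ℕ}
    (hG : G.IsVertexConnected k) :
    pprob (colourWeight ι q)
      (fun X : V → Option ι ↦ ¬ ∀ i, G.IsTotalDominatingSet {v | X v = some i}) ≤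
      Fintype.card ι * Fintype.card V * (1 - q / Fintype.card ι) ^ k := by
  classical
  have hw := isProbWeight_colourWeight (ι := ι) h0 h1
  have hr0 : 0 ≤ q / Fintype.card ι := by positivity
  have hr1 : q / Fintype.card ι ≤ 1 :=
    (div_le_self h0 (by exact_mod_cast Fintype.card_pos)).trans h1
  calc _ ≤ pprob (colourWeight ι q) (fun X : V → Option ι ↦ ∃ x ∈ (Finset.univ : Finset (ι × V)),
        ∀ u ∈ (Set.toFinite (G.neighborSet x.2)).toFinset, X u ≠ some x.1) := by
        refine pprob_mono hw fun X hX ↦ ?_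
        simp only [IsTotalDominatingSet] at hX
        push Not at hX
        obtain ⟨i, v, hv⟩ := hX
        refine ⟨(i, v), Finset.mem_univ _, fun u hu hXu ↦ hv u hXu ?_⟩
        simpa using hu
    _ ≤ ∑ x : ι × V, (1 - q / Fintype.card ι) ^ k := by
        refine (pprob_exists_le hw _ _).trans (Finset.sum_le_sum fun x _ ↦ ?_)
        rw [pprob_colour_avoid h0 h1]
        refine pow_le_pow_of_le_one (by linarith) (by linarith) ?_
        rw [← Set.ncard_eq_toFinset_card _ _]
        exact hG.le_ncard_neighborSet x.2
    _ = _ := by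
        rw [Finset.sum_const, nsmul_eq_mul, Finset.card_univ, Fintype.card_prod, Nat.cast_mul]

/-- Failure means that some initial colour class is not dominating, or that the rounds fail. The
load is 1 from the initial colour plus 2 per round. -/
theorem pprob_not_hasDominatingFamily_le [Nonempty V] [Nonempty ι] {p q : ℝ} (h0 : 0 ≤ q)
    (h1 : q ≤ 1 / 2) {k m R : ℕ} (hG : G.IsVertexConnected k)
    (hkq : 2 ≤ k * (q / Fintype.card ι)) (hmk : 4 * m ≤ k)
    (hl : 1 / 4 ≤ m * (q * (q / Fintype.card ι))) (hu : m * (q * (q / Fintype.card ι)) ≤ 1 / 2)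
    (hp1 : p ≤ 1) (hp : 1 - p ≤ (1 - q) ^ (2 * R + 1)) :
    pprob (coinWeight p) (fun S : V → Prop ↦ ¬ HasDominatingFamily ι G {v | S v} (2 * R + 1)) ≤
      Fintype.card ι * Fintype.card V * ((1 - q / Fintype.card ι) ^ k + (31 / 32) ^ R) := by
  have h1' : q ≤ 1 := by linarith
  have hw := isProbWeight_colourWeight (ι := ι) h0 h1'
  obtain ⟨p', hp'0, hp'1, hpp', hp'⟩ := one_sub_div_split (n := 2 * R) (by linarith) hp1 h0 hp
  have hwp := isProbWeight_coinWeight hp'0 hp'1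
  rw [pprob, pexp_coinWeight_split_colour (ι := ι) hpp']
  have hstep : ∀ X : V → Option ι, (pexp (coinWeight p') fun Z : V → Prop ↦
      indicatorProp (¬ HasDominatingFamily ι G {v | (X v).isSome ∨ Z v} (2 * R + 1))) ≤
      indicatorProp (¬ ∀ i, G.IsTotalDominatingSet {v | X v = some i}) +
        (31 / 32) ^ R * (Fintype.card ι * Fintype.card V) := by
    intro X
    by_cases hX : ∀ i, G.IsTotalDominatingSet {v | X v = some i}
    · rw [indicatorProp_of_not (not_not.2 hX), zero_add]
      refine le_trans ?_ ((pprob_not_hasConnectedExtension_le h0 h1 hG hkq hmk hl hu R p' hp'0 hp'1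
        hp' (fun i ↦ {v | X v = some i}) hX).trans
        (mul_le_mul_of_nonneg_left (excess_le G _) (by positivity)))
      refine pexp_mono hwp fun Z ↦ indicatorProp_mono fun hZ hext ↦ hZ ?_
      obtain ⟨τ, hAτ, hτ, hconn, hload⟩ := hext
      refine ⟨τ, fun i ↦ (hτ i).trans ?_, fun i ↦ (hX i).mono (hAτ i), hconn, fun v ↦ ?_⟩
      · rintro v (hv | hv)
        · have hv' : X v = some i := hv
          exact Or.inl (by simp [hv'])
        · exact Or.inr hv
      · have hsub : {i | v ∈ τ i} ⊆ {i | v ∈ τ i ∧ v ∉ {v | X v = some i}} ∪ {i | X v = some i} := by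
          intro i hi
          by_cases h : X v = some i
          · exact Or.inr h
          · exact Or.inl ⟨hi, h⟩
        have hone : {i | X v = some i}.ncard ≤ 1 := by
          rw [Set.ncard_le_one]
          intro i hi j hj
          exact Option.some.inj (hi.symm.trans hj)
        exact (Set.ncard_le_ncard hsub).trans
          ((Set.ncard_union_le _ _).trans (add_le_add (hload v) hone))
    · rw [indicatorProp_of_true hX]
      have h1 : pprob (coinWeight p') _ ≤ 1 := pprob_le_one hwp
        (fun Z : V → Prop ↦ ¬ HasDominatingFamily ι G {v | (X v).isSome ∨ Z v} (2 * R + 1))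
      have h2 : (0 : ℝ) ≤ (31 / 32) ^ R * (Fintype.card ι * Fintype.card V) := by positivity
      exact h1.trans (by linarith)
  refine (pexp_mono hw hstep).trans ?_
  rw [pexp_add, pexp_const hw, mul_add]
  refine add_le_add (pprob_not_isTotalDominatingSet_le h0 h1' hG) (by rw [mul_comm])

end Sampling

/-! ### Choice of parameters. -/

section Parameters

theorem exists_matching_size {k : ℕ} {r : ℝ} (hr0 : 0 < r) (hr : r ≤ 1 / 4) (hk : 2 ≤ k * r) :
    ∃ m : ℕ, 4 * m ≤ k ∧ 1 / 4 ≤ m * r ∧ m * r ≤ 1 / 2 := by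
  have hlow : 1 / (4 * r) ≤ (⌈1 / (4 * r)⌉₊ : ℝ) := Nat.le_ceil _
  have hhigh : (⌈1 / (4 * r)⌉₊ : ℝ) < 1 / (4 * r) + 1 := Nat.ceil_lt_add_one (by positivity)
  have hmr : 1 / (4 * r) * r = 1 / 4 := by field_simp
  have h1 := mul_le_mul_of_nonneg_right hlow hr0.le
  have h2 := mul_lt_mul_of_pos_right hhigh hr0
  rw [hmr] at h1
  rw [add_mul, hmr] at h2
  refine ⟨_, ?_, h1, by linarith⟩
  have h3 : (4 * ⌈1 / (4 * r)⌉₊ : ℝ) * r ≤ k * r := by linarith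
  exact_mod_cast le_of_mul_le_mul_right h3 hr0

theorem pprob_not_hasDominatingFamily_le_rpow {V : Type*} [Fintype V] [DecidableEq V]
    {G : SimpleGraph V} {a : ℝ} (ha : 0 < a) {k R t : ℕ} {p : ℝ} (hp1 : p ≤ 1) (hp0 : 0 ≤ p)
    (hG : G.IsVertexConnected k) (hn : 2 ≤ Fintype.card V)
    (hR : 32 * (a + 3) * Real.log (Fintype.card V) ≤ R) (hR1 : 1 ≤ R) (ht1 : 1 ≤ t)
    (ht : 2 * t ≤ k * (p / (2 * R + 1 : ℕ)) ^ 2) :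
    pprob (coinWeight p)
      (fun S : V → Prop ↦ ¬ HasDominatingFamily (Fin t) G {v | S v} (2 * R + 1)) ≤
      (Fintype.card V : ℝ) ^ (-a) := by
  have : Nonempty V := Fintype.card_pos_iff.1 (by omega)
  have : Nonempty (Fin t) := ⟨⟨0, ht1⟩⟩
  set n := Fintype.card V with hn_def
  set N : ℕ := 2 * R + 1 with hN
  set q : ℝ := p / N with hq
  have hn2 : (2 : ℝ) ≤ n := by exact_mod_cast hn
  have hlog : 0 < Real.log n := Real.log_pos (by linarith)
  have hR1' : (1 : ℝ) ≤ R := by exact_mod_cast hR1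
  have hNR : (N : ℝ) = 2 * R + 1 := by rw [hN]; push_cast; ring
  have hN0 : (0 : ℝ) < N := by rw [hNR]; linarith
  have ht1' : (1 : ℝ) ≤ t := by exact_mod_cast ht1
  have hq0 : 0 ≤ q := by positivity
  have hqpos : 0 < q := by
    refine hq0.lt_of_ne fun h ↦ ?_
    rw [← h] at ht
    norm_num at ht
    linarith
  have hqN : q * N ≤ 1 := by rw [hq, div_mul_cancel₀ _ hN0.ne']; exact hp1
  have hq2 : q ≤ 1 / 2 := by nlinarith
  have hkn : (k : ℝ) ≤ n := by
    have := hG.1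
    rw [Nat.card_eq_fintype_card] at this
    exact_mod_cast this.le
  have htn : (t : ℝ) ≤ n := by
    have : (k : ℝ) * q ^ 2 ≤ k * 1 :=
      mul_le_mul_of_nonneg_left (pow_le_one₀ hq0 (by linarith)) (by positivity)
    linarith
  have hkr : 2 ≤ k * (q * (q / t)) := by
    rw [show (k : ℝ) * (q * (q / t)) = k * q ^ 2 / t by ring, le_div_iff₀ (by linarith)]
    exact ht
  -- Since qN = p ≤ 1, dropping one factor q from `hkr` gains N, which is logarithmic; this makes
  -- the initial domination hold with high probability.
  have hkqN : 2 * N ≤ k * (q / t) := by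
    have h1 : 2 * N ≤ (k * (q * (q / t))) * N := mul_le_mul_of_nonneg_right hkr hN0.le
    have h2 : (k * (q / t)) * (q * N) ≤ (k * (q / t)) * 1 :=
      mul_le_mul_of_nonneg_left hqN (by positivity)
    linarith
  obtain ⟨m, hm, hl, hu⟩ := exists_matching_size (k := k) (r := q * (q / t)) (by positivity) (by
    have : q / t ≤ q := div_le_self hq0 ht1'
    nlinarith) hkr
  have hpow : 1 - p ≤ (1 - q) ^ N := by
    have h := one_add_mul_le_pow (a := -q) (by linarith) N
    have : (N : ℝ) * q = p := by rw [hq, mul_div_cancel₀ _ hN0.ne']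
    rw [← sub_eq_add_neg] at h
    linarith
  have hmain := pprob_not_hasDominatingFamily_le (ι := Fin t) (p := p) hq0 hq2 hG
    (by rw [Fintype.card_fin]; linarith) hm (by rw [Fintype.card_fin]; exact hl)
    (by rw [Fintype.card_fin]; exact hu) hp1 hpow
  refine hmain.trans ?_
  rw [Fintype.card_fin, ← hn_def]
  have hrt : q / t ≤ 1 := (div_le_self hq0 ht1').trans (by linarith)
  have hdom : (1 - q / t) ^ k ≤ Real.exp (-((a + 3) * Real.log n)) := by
    calc (1 - q / t) ^ k ≤ Real.exp (-(q / t)) ^ k :=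
          pow_le_pow_left₀ (by linarith) (Real.one_sub_le_exp_neg _) _
      _ = Real.exp (-(k * (q / t))) := by rw [← Real.exp_nat_mul]; ring_nf
      _ ≤ _ := by
          refine Real.exp_le_exp.2 (neg_le_neg ?_)
          have : 0 ≤ (a + 3) * Real.log n := by positivity
          linarith
  have hrounds : (31 / 32 : ℝ) ^ R ≤ Real.exp (-((a + 3) * Real.log n)) := by
    calc (31 / 32 : ℝ) ^ R ≤ Real.exp (-(1 / 32)) ^ R :=
          pow_le_pow_left₀ (by norm_num) (by linarith [Real.one_sub_le_exp_neg (1 / 32)]) _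
      _ = Real.exp (-(R / 32)) := by rw [← Real.exp_nat_mul]; ring_nf
      _ ≤ _ := Real.exp_le_exp.2 (by linarith)
  -- The exponent a + 3 pays for the t·n ≤ n² union bound and for the two failure terms, as 2/n ≤ 1.
  have hexp : Real.exp (-((a + 3) * Real.log n)) = (n : ℝ) ^ (-a) / n ^ 3 := by
    rw [← Real.rpow_natCast, ← Real.rpow_sub (by linarith), Real.rpow_def_of_pos (by linarith)]
    congr 1
    push_cast
    ring
  have hna : 0 ≤ (n : ℝ) ^ (-a) := by positivity
  calc (t : ℝ) * n * ((1 - q / t) ^ k + (31 / 32) ^ R)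
      ≤ n * n * ((n : ℝ) ^ (-a) / n ^ 3 + (n : ℝ) ^ (-a) / n ^ 3) := by
        rw [← hexp]
        gcongr
    _ = (n : ℝ) ^ (-a) * (2 / n) := by field_simp; ring
    _ ≤ (n : ℝ) ^ (-a) * 1 :=
        mul_le_mul_of_nonneg_left ((div_le_one (by linarith)).2 hn2) hna
    _ = _ := mul_one _

end Parameters

end SimpleGraph

/-! ### The theorem: constants and assembly. -/

open SimpleGraph in
theorem theorem4 :
    ∀ a : ℝ, 0 < a → ∃ c C : ℝ, 0 < c ∧ 0 < C ∧
      ∀ (V : Type*) [Finite V] (G : SimpleGraph V) (k : ℕ) (p : I),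
        G.IsVertexConnected k →
        C * Real.log (Nat.card V) ^ 2 ≤ k * (p : ℝ) ^ 2 →
        1 - (Nat.card V : ℝ) ^ (-a) ≤
          (setBer((Set.univ : Set V), p)).real
            {S : Set V |
              (∃ P : (G.induce S).CDSPacking,
                c * (k * (p : ℝ) ^ 2 / Real.log (Nat.card V) ^ 3) ≤ P.size) ∧
              c * (k * (p : ℝ) ^ 2 / Real.log (Nat.card V) ^ 3) ≤
                (G.induce S).vertexConnectivity} := by
  intro a ha
  -- Chosen so that N < 64(a+3)l + 3 ≤ bl, using l ≥ 1/2. Then C = 2b² makes y/(2N²) ≥ 1, and c =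
  -- 1/(8b³) comes from t/(2N) ≥ y/(8N³).
  set b : ℝ := 64 * (a + 3) + 6 with hb
  have hb0 : 0 < b := by positivity
  refine ⟨1 / (8 * b ^ 3), 2 * b ^ 2, by positivity, by positivity, ?_⟩
  intro V _ G k p hG hkp
  classical
  have : Fintype V := Fintype.ofFinite V
  rcases (Nat.succ_le_of_lt ((Nat.zero_le k).trans_lt hG.1)).eq_or_lt with hone | htwo
  -- For n = 1 the required probability is 1 - 1 = 0.
  · rw [← hone]
    simp
  rw [Nat.card_eq_fintype_card] at hkp htwo ⊢
  rw [setBernoulli_real_eq_pprob]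
  set n := Fintype.card V with hn
  set l := Real.log n with hl
  have hn2 : (2 : ℝ) ≤ n := by exact_mod_cast htwo
  have hl2 : 1 / 2 ≤ l := by
    have := Real.log_le_log (by norm_num) hn2
    linarith [Real.log_two_gt_d9]
  have hl0 : 0 < l := by linarith
  have hRpos : 0 < 32 * (a + 3) * l := by positivity
  set R := ⌈32 * (a + 3) * l⌉₊ with hR
  have hRle : 32 * (a + 3) * l ≤ R := Nat.le_ceil _
  have hRlt : (R : ℝ) < 32 * (a + 3) * l + 1 := Nat.ceil_lt_add_one hRpos.le
  set N : ℕ := 2 * R + 1 with hN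
  have hNR : (N : ℝ) = 2 * R + 1 := by rw [hN]; push_cast; ring
  have hN0 : (0 : ℝ) < N := by rw [hNR]; positivity
  have hNb : (N : ℝ) ≤ b * l := by rw [hNR, hb]; linarith
  set y : ℝ := k * (p : ℝ) ^ 2 with hy
  have hkN : (k : ℝ) * ((p : ℝ) / N) ^ 2 = y / N ^ 2 := by rw [hy]; ring
  have hN2 : (N : ℝ) ^ 2 ≤ b ^ 2 * l ^ 2 := by
    rw [← mul_pow]
    exact pow_le_pow_left₀ hN0.le hNb 2
  have hone_le : 1 ≤ y / N ^ 2 / 2 := by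
    rw [le_div_iff₀ (by norm_num), le_div_iff₀ (by positivity)]
    linarith
  set t := ⌊y / N ^ 2 / 2⌋₊ with ht
  have ht1 : 1 ≤ t := Nat.le_floor (by exact_mod_cast hone_le)
  have htle : (t : ℝ) ≤ y / N ^ 2 / 2 := Nat.floor_le (by linarith)
  have htge : y / N ^ 2 / 4 ≤ t := by
    have h1 := Nat.lt_floor_add_one (y / N ^ 2 / 2)
    have h2 : (1 : ℝ) ≤ t := by exact_mod_cast ht1
    linarith
  have hfail := pprob_not_hasDominatingFamily_le_rpow (G := G) ha p.2.2 p.2.1 hG htwo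
    hRle (Nat.one_le_ceil_iff.2 hRpos) ht1 (by rw [← hN, hkN]; linarith)
  have hw := isProbWeight_coinWeight p.2.1 p.2.2
  rw [pprob_not hw] at hfail
  have hsize : 1 / (8 * b ^ 3) * (y / l ^ 3) ≤ t / (2 * N) := by
    have hy0 : 0 ≤ y := by positivity
    calc 1 / (8 * b ^ 3) * (y / l ^ 3) = y / (8 * (b * l) ^ 3) := by
          field_simp
      _ ≤ y / (8 * N ^ 3) := by gcongr
      _ = y / N ^ 2 / 4 / (2 * N) := by field_simp; ring
      _ ≤ _ := by gcongr
  have : Nonempty (Fin t) := ⟨⟨0, ht1⟩⟩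
  refine le_trans (by linarith) (pprob_mono hw
    (P := fun S : V → Prop ↦ HasDominatingFamily (Fin t) G {v | S v} N) fun S hS ↦ ?_)
  obtain ⟨⟨P, hP⟩, hconn⟩ := hS.packing_and_connectivity (by omega)
  rw [Fintype.card_fin] at hP hconn
  refine ⟨⟨P, hsize.trans ?_⟩, hsize.trans hconn⟩
  rw [hP]
  gcongr
  linarith
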